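/- **Conventions.** Fix a universe of sets; categories are locally small. A profunctor $P\colon \mathcal C\nrightarrow\mathcal D$ is a functor $P\colon\mathcal D^{\mathrm{op}}\times\mathcal C\to\mathbf{Set}$; it is *small* if every $P(-,c)$ is a small colimit of representables. Profunctors compose by coends, and a functor $f\colon\mathcal C\to\mathcal D$ gives $f_\diamond(d,c)=\mathcal D(d,fc)$. **The pseudomonad $\beta$.** For a category $\mathcal C$, $\beta\mathcal C$ has as objects ultrafamilies $(X,b,\nu)$: a set $X$, objects $b_x\in\mathcal C$ ($x\in X$), an ultrafilter $\nu$ on $X$. A morphism $(X,b,\nu)\to(Y,c,\xi)$ is a function $g\colon Y\to X$ with $g_*\xi=\nu$ together with morphisms $b_{g(y)}\to c_y$ for $y \in Y$, up to equality $\xi$-almost everywhere. The unit $\eta$ is $a\mapsto (a)_{*:1}$ and the multiplication $\mu$ is given by direct sums $\sum_{x:\nu}\xi_x$ of ultrafilters. $\beta$ extends to profunctors: an element of $(\beta P)((Y,d,\nu),(X,c,\xi))$ is a function $g\colon X\to Y$ with $g_*\xi=\nu$ together with elements of $P(d_{g(x)},c_x)$, up to equality $\xi$-almost everywhere (equivalently,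 $\beta P=(\beta\,\mathrm{dom})_\diamond\circ(\beta\,\mathrm{cod})^\diamond$ for the two-sided discrete fibration of $P$). **Algebras.** A *lax $\beta$-algebra* is a small profunctor $A\colon\beta A_0\nrightarrow A_0$ with 2-cells $\Gamma\colon 1\Rightarrow A\circ\eta_\diamond$ and $\Delta\colon A\circ\beta A\Rightarrow A\circ\mu_\diamond$ satisfying the two unit laws and the associativity law. A *representable colax morphism* $A\to B$ is a functor $f\colon A_0\to B_0$ with a 2-cell $\Theta_f\colon f_\diamond\circ A\Rightarrow B\circ\beta(f_\diamond)$ compatible with $\Gamma$ and $\Delta$. An *algebra 2-cell* $f_\diamond\Rightarrow g_\diamond$ is a 2-cell of profunctors $\sigma\colon f_\diamond\Rightarrow g_\diamond$ with $(B\circ\beta\sigma)\cdot\Theta_f=\Theta_g\cdot(\sigma\circ A)$. The category $\mathrm{pt}(A)$ has the objects of $A_0$ and morphisms $a\to a'$ the elements of $A(a,\eta a')$; $A$ is *normalized* if the comparison functor $A_0\to\mathrm{pt}(A)$ induced by $\Gamma$ is fully faithful. The sets $A(a,(X,b,\nu))$ also carry a normalized lax $\beta$-algebra structure on $\mathrm{pt}(A)$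 when $A_0$ is discrete. **Ultraconvergence spaces.** An *ultraconvergence space* $A$ is a discrete category $A_0$ with a small profunctor $A\colon\beta A_0\nrightarrow A_0$, whose elements are written $r\colon a\rightsquigarrow(b_x)_{x:\nu}$, with identities $\mathrm{id}_a\colon a\rightsquigarrow(a)_{*:1}$ and composites $(s_x)_{x:\nu}\cdot r\colon a\rightsquigarrow(c_{x,y})_{(x,y):\sum_{x:\nu}\xi_x}$ for $s_x\colon b_x\rightsquigarrow(c_{x,y})_{y:\xi_x}$, subject to left and right naturality, left and right unitality, and associativity. A *continuous map* $f\colon A\to A'$ is a functor $f\colon A_0\to A_0'$ with functions $A(a,(X,b,\nu))\to A'(fa,(X,fb,\nu))$, also written $f$, which preserve reindexing, identities and composites. A *transformation* $\alpha\colon f\Rightarrow g$ is a family $\alpha_a\colon f(a)\rightsquigarrow(g(a))_{*:1}$, $a\in A_0$, with $g(r)\cdot\alpha_a=(\alpha_{b_x})_{x:\nu}\cdot f(r)$ for all $r\colon a\rightsquigarrow(b_x)_{x:\nu}$. An ultraconvergence space is a lax $\beta$-algebra on $A_0$, and is seen as a normalized lax $\beta$-algebra by passing to $\mathrm{pt}(A)$;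 a continuous map $f$ is then seen as the representable colax morphism given by the induced functor $\mathrm{pt}(A)\to\mathrm{pt}(A')$, with $\Theta_f(h,r)=f(r)\cdot h$ for $h \in \mathrm{pt}(A')(d, f c)$ and $r \in A(c, X)$. **Proposition.** Let $A,A'$ be ultraconvergence spaces seen as normalized lax $\beta$-algebras, and let $f,g\colon A\to A'$ be continuous maps seen as representable colax morphisms. Then there is a bijection between 1. transformations $f\Rightarrow g$, and 2. algebra 2-cells $f_\diamond\Rightarrow g_\diamond$, under which a transformation $\alpha$ corresponds to the algebra 2-cell $\sigma$ with $\sigma(\mathrm{id}_{f(a)})=\alpha_a$ for every point $a$. -/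

import Mathlib

open CategoryTheory Opposite

universe w v v₁ v₂ v₃ u u₁ u₂ u₃

namespace UltraConv

/-! ### Ultrafilters: direct sums, and germs of families -/

section Germs

/-- The direct sum `∑_{i:μ} lam i`: a subset `S` of the disjoint union belongs to it iff
`S ∩ A i ∈ lam i` for `μ`-almost all `i` (see `eventually_sumU`). -/
def sumU {I : Type w} {A : I → Type w} (μ : Ultrafilter I) (lam : ∀ i, Ultrafilter (A i)) :
    Ultrafilter (Σ i, A i) :=
  Ultrafilter.bind μ (fun i => (lam i).map (Sigma.mk i))

theorem eventually_sumU {I : Type w} {A : I → Type w} {μ : Ultrafilter I}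
    {lam : ∀ i, Ultrafilter (A i)} {p : (Σ i, A i) → Prop} :
    (∀ᶠ x in (sumU μ lam : Filter _), p x) ↔
      ∀ᶠ i in (μ : Filter I), ∀ᶠ a in (lam i : Filter (A i)), p ⟨i, a⟩ :=
  Iff.rfl

theorem ultrafilter_ext {I : Type w} {μ ν : Ultrafilter I}
    (h : ∀ p : I → Prop, (∀ᶠ i in (μ : Filter I), p i) ↔ ∀ᶠ i in (ν : Filter I), p i) : μ = ν :=
  Ultrafilter.ext fun s => h (fun i => i ∈ s)

theorem eventually_of_map {I J : Type w} {μ : Ultrafilter I} {ν : Ultrafilter J} {g : J → I}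
    (h : ν.map g = μ) {p : I → Prop} :
    (∀ᶠ i in (μ : Filter I), p i) ↔ ∀ᶠ j in (ν : Filter J), p (g j) := by
  subst h; exact Iff.rfl

/-- Given `E i j` for `i ∈ I` and `j ∈ J`, a measure-preserving function `g : J → I` together with
a family of elements `e j ∈ E (g j) j`. -/
structure PreGerm {I J : Type w} (μ : Ultrafilter I) (ν : Ultrafilter J) (E : I → J → Type v) where
  fam : ∀ j, Σ i, E i j
  push : ν.map (fun j => (fam j).1) = μ

variable {I J K L : Type w} {μ : Ultrafilter I} {ν : Ultrafilter J} {κ : Ultrafilter K}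
  {ρ : Ultrafilter L}

/-- Two families `(g, e)` and `(g', e')` are identified when they agree `ν`-almost everywhere. -/
instance PreGerm.setoid (μ : Ultrafilter I) (ν : Ultrafilter J) (E : I → J → Type v) :
    Setoid (PreGerm μ ν E) where
  r s t := ∀ᶠ j in (ν : Filter J), s.fam j = t.fam j
  iseqv :=
    { refl := fun _ => Filter.Eventually.of_forall fun _ => rfl
      symm := fun h => h.mono fun _ h => h.symm
      trans := fun h h' => by filter_upwards [h, h'] with j a b using a.trans b }

/-- Families `(g, e)` up to almost-everywhere equality. -/
def UGerm (μ : Ultrafilter I) (ν : Ultrafilter J) (E : I → J → Type v) : Type (max w v) :=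
  Quotient (PreGerm.setoid μ ν E)

namespace UGerm

variable {E : I → J → Type v} {E' : J → K → Type v₁} {F : I → K → Type v₂}

/-- The class of a family. -/
def mk (s : PreGerm μ ν E) : UGerm μ ν E := Quotient.mk _ s

/-- The class of the family `(g, e)`. -/
def of (g : J → I) (h : ν.map g = μ) (e : ∀ j, E (g j) j) : UGerm μ ν E :=
  mk ⟨fun j => ⟨g j, e j⟩, h⟩

theorem ind {p : UGerm μ ν E → Prop} (h : ∀ g hg e, p (of g hg e)) (t : UGerm μ ν E) : p t :=
  Quotient.inductionOn t fun s => h (fun j => (s.fam j).1) s.push (fun j => (s.fam j).2)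

theorem of_eq {g g' : J → I} {h : ν.map g = μ} {h' : ν.map g' = μ} {e : ∀ j, E (g j) j}
    {e' : ∀ j, E (g' j) j}
    (H : ∀ᶠ j in (ν : Filter J), (⟨g j, e j⟩ : Σ i, E i j) = ⟨g' j, e' j⟩) :
    of g h e = of g' h' e' :=
  Quotient.sound H

theorem of_eq_iff {g g' : J → I} {h : ν.map g = μ} {h' : ν.map g' = μ} {e : ∀ j, E (g j) j}
    {e' : ∀ j, E (g' j) j} : of g h e = of g' h' e' ↔
    ∀ᶠ j in (ν : Filter J), (⟨g j, e j⟩ : Σ i, E i j) = ⟨g' j, e' j⟩ :=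
  ⟨fun H => Quotient.exact H, of_eq⟩

theorem of_congr {g : J → I} {h : ν.map g = μ} {e e' : ∀ j, E (g j) j} (H : ∀ j, e j = e' j) :
    of g h e = of g h e' := by rw [funext H]

/-- Apply a map to each member of a family. -/
def map {E₁ : I → J → Type v₁} (m : ∀ i j, E i j → E₁ i j) (t : UGerm μ ν E) : UGerm μ ν E₁ :=
  Quotient.map (fun s : PreGerm μ ν E =>
    (⟨fun j => ⟨(s.fam j).1, m _ _ (s.fam j).2⟩, s.push⟩ : PreGerm μ ν E₁))
    (fun _ _ h => Filter.Eventually.mono h fun j hj =>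
      congrArg (fun x : Σ i, E i j => (⟨x.1, m _ _ x.2⟩ : Σ i, E₁ i j)) hj) t

@[simp] theorem map_of {E₁ : I → J → Type v₁} (m : ∀ i j, E i j → E₁ i j) (g : J → I)
    (h : ν.map g = μ) (e : ∀ j, E (g j) j) :
    map m (of g h e) = of g h (fun j => m _ _ (e j)) := rfl

/-- Compose families pointwise: `(g, e)` and `(g', e')` give `(g ∘ g', m (e (g' k)) (e' k))`. -/
def comp (m : ∀ i j k, E i j → E' j k → F i k) (s : UGerm μ ν E) (t : UGerm ν κ E') :
    UGerm μ κ F :=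
  Quotient.map₂ (fun (s : PreGerm μ ν E) (t : PreGerm ν κ E') =>
    (⟨fun k => ⟨(s.fam (t.fam k).1).1, m _ _ _ (s.fam (t.fam k).1).2 (t.fam k).2⟩, by
      refine Eq.trans ?_ s.push
      exact (Ultrafilter.map_map κ (fun k => (t.fam k).1) (fun j => (s.fam j).1)).symm.trans
        (congrArg (Ultrafilter.map fun j => (s.fam j).1) t.push)⟩ : PreGerm μ κ F))
    (fun s s' hs t t' ht => by
      filter_upwards [ht, (eventually_of_map t.push).1 hs] with k h1 h2
      rw [← h1, h2]) s t

@[simp] theorem comp_of (m : ∀ i j k, E i j → E' j k → F i k) (g : J → I) (h : ν.map g = μ)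
    (e : ∀ j, E (g j) j) (g' : K → J) (h' : κ.map g' = ν) (e' : ∀ k, E' (g' k) k) :
    comp m (of g h e) (of g' h' e') =
      of (fun k => g (g' k)) (by rw [← h, ← h', Ultrafilter.map_map]; rfl)
        (fun k => m _ _ _ (e (g' k)) (e' k)) := rfl

variable {A : I → Type w} {B : J → Type w} {lam : ∀ i, Ultrafilter (A i)}
  {kap : ∀ j, Ultrafilter (B j)}

theorem sum_push {g : J → I} (hg : ν.map g = μ) {k : ∀ j, B j → A (g j)}
    (hk : ∀ j, (kap j).map (k j) = lam (g j)) :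
    (sumU ν kap).map (fun p : Σ j, B j => (⟨g p.1, k p.1 p.2⟩ : Σ i, A i)) = sumU μ lam := by
  apply ultrafilter_ext
  intro p
  rw [eventually_sumU, eventually_of_map hg]
  change (∀ᶠ j in (ν : Filter J), ∀ᶠ b in (kap j : Filter (B j)), p ⟨g j, k j b⟩) ↔ _
  refine Filter.eventually_congr (Filter.Eventually.of_forall fun j => ?_)
  rw [eventually_of_map (hk j)]

/-- Flatten a family of classes of families to (the class of) a family on the direct sum. -/
noncomputable def sum {E : (Σ i, A i) → (Σ j, B j) → Type v}
    (T : UGerm μ ν fun i j => UGerm (lam i) (kap j) fun a b => E ⟨i, a⟩ ⟨j, b⟩) :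
    UGerm (sumU μ lam) (sumU ν kap) E :=
  Quotient.lift
    (fun T : PreGerm μ ν fun i j => UGerm (lam i) (kap j) fun a b => E ⟨i, a⟩ ⟨j, b⟩ =>
      (of (fun p => ⟨(T.fam p.1).1, ((T.fam p.1).2.out.fam p.2).1⟩)
        (sum_push (k := fun j b => ((T.fam j).2.out.fam b).1) T.push
          (fun j => (T.fam j).2.out.push))
        (fun p => ((T.fam p.1).2.out.fam p.2).2) : UGerm (sumU μ lam) (sumU ν kap) E))
    (fun _ _ h => of_eq <| eventually_sumU.2 <| Filter.Eventually.mono h fun j hj =>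
      Filter.Eventually.of_forall fun b =>
        congrArg (fun x : Σ i, UGerm (lam i) (kap j) fun a b => E ⟨i, a⟩ ⟨j, b⟩ =>
          (⟨⟨x.1, (x.2.out.fam b).1⟩, (x.2.out.fam b).2⟩ : Σ i, E i ⟨j, b⟩)) hj) T

theorem sum_of {E : (Σ i, A i) → (Σ j, B j) → Type v} (g : J → I) (hg : ν.map g = μ)
    (k : ∀ j, B j → A (g j)) (hk : ∀ j, (kap j).map (k j) = lam (g j))
    (e : ∀ j b, E ⟨g j, k j b⟩ ⟨j, b⟩) :
    sum (E := E) (of g hg fun j => of (k j) (hk j) (e j)) =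
      of (fun p => ⟨g p.1, k p.1 p.2⟩) (sum_push hg hk) (fun p => e p.1 p.2) := by
  refine of_eq (eventually_sumU.2 (Filter.Eventually.of_forall fun j => ?_))
  have := Quotient.mk_out (s := PreGerm.setoid (lam (g j)) (kap j) (fun a b => E ⟨g j, a⟩ ⟨j, b⟩))
    (⟨fun b => ⟨k j b, e j b⟩, hk j⟩)
  refine Filter.Eventually.mono this fun b hb => ?_
  exact congrArg (fun x : Σ a, E ⟨g j, a⟩ ⟨j, b⟩ => (⟨⟨g j, x.1⟩, x.2⟩ : Σ i, E i ⟨j, b⟩)) hb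

/-- Induction for families of classes of families. -/
theorem ind₂ {E : ∀ i j, A i → B j → Type v}
    {p : (UGerm μ ν fun i j => UGerm (lam i) (kap j) (E i j)) → Prop}
    (h : ∀ (g : J → I) (hg : ν.map g = μ) (k : ∀ j, B j → A (g j))
      (hk : ∀ j, (kap j).map (k j) = lam (g j)) (e : ∀ j b, E (g j) j (k j b) b),
      p (of g hg fun j => of (k j) (hk j) (e j)))
    (T : UGerm μ ν fun i j => UGerm (lam i) (kap j) (E i j)) : p T := by
  refine ind (fun g hg e => ?_) T
  have : ∀ j, of (fun b => ((e j).out.fam b).1) (e j).out.push (fun b => ((e j).out.fam b).2)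
      = e j := fun j => Quotient.out_eq (e j)
  have H := h g hg (fun j b => ((e j).out.fam b).1) (fun j => (e j).out.push)
    (fun j b => ((e j).out.fam b).2)
  simpa only [this] using H

end UGerm

end Germs

/-! ### The ultracompletion of a category -/

/-- An ultrafamily of objects of `C`: a set `ι`, a family of objects indexed by `ι`, and an
ultrafilter on `ι`. -/
structure UltraFamily (C : Type u) where
  ι : Type w
  obj : ι → C
  uf : Ultrafilter ι

section Ultracompletion

variable {C : Type u₁} [Category.{w} C] {D : Type u₂} [Category.{w} D]
  {E : Type u₃} [Category.{w} E]

/-- The category `β C` of ultrafamilies in `C`: a morphism `(X, h, ν) ⟶ (X', h', ν')` is a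
function `g : X' → X` which pushes `ν'` to `ν`, with a family of morphisms `h (g x) ⟶ h' x`
for `x ∈ X'`, up to equality `ν'`-almost everywhere. -/
instance UltraFamily.category : Category.{w} (UltraFamily.{w} C) where
  Hom X Y := UGerm X.uf Y.uf fun i j => (X.obj i ⟶ Y.obj j)
  id X := UGerm.of id (Ultrafilter.map_id _) fun i => 𝟙 (X.obj i)
  comp {X Y Z} f g := UGerm.comp (E := fun i j => (X.obj i ⟶ Y.obj j))
    (E' := fun j k => (Y.obj j ⟶ Z.obj k)) (F := fun i k => (X.obj i ⟶ Z.obj k))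
    (fun _ _ _ f g => f ≫ g) f g
  id_comp {X Y} f := by
    induction f using UGerm.ind with | _ g hg e
    exact UGerm.of_congr (E := fun i j => (X.obj i ⟶ Y.obj j)) (g := g) (h := hg) fun j => Category.id_comp (e j)
  comp_id {X Y} f := by
    induction f using UGerm.ind with | _ g hg e
    exact UGerm.of_congr (E := fun i j => (X.obj i ⟶ Y.obj j)) (g := g) (h := hg) fun j => Category.comp_id (e j)
  assoc {W X Y Z} f g h := by
    induction f using UGerm.ind with | _ k hk e
    induction g using UGerm.ind with | _ k' hk' e'
    induction h using UGerm.ind with | _ k'' hk'' e''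
    exact UGerm.of_congr (E := fun i j => (W.obj i ⟶ Z.obj j)) (g := fun j => k (k' (k'' j)))
      fun j => Category.assoc (e _) (e' _) (e'' j)

namespace UltraFamily

/-- Morphisms of `β C`, from representatives. -/
def homMk {X Y : UltraFamily.{w} C} (g : Y.ι → X.ι) (hg : Y.uf.map g = X.uf)
    (e : ∀ j, X.obj (g j) ⟶ Y.obj j) : X ⟶ Y :=
  (UGerm.of g hg e : UGerm X.uf Y.uf fun i j => (X.obj i ⟶ Y.obj j))

theorem homMk_eq {X Y : UltraFamily.{w} C} {g g' : Y.ι → X.ι} {hg : Y.uf.map g = X.uf}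
    {hg' : Y.uf.map g' = X.uf} {e : ∀ j, X.obj (g j) ⟶ Y.obj j} {e' : ∀ j, X.obj (g' j) ⟶ Y.obj j}
    (H : ∀ᶠ j in (Y.uf : Filter Y.ι),
      (⟨g j, e j⟩ : Σ i, (X.obj i ⟶ Y.obj j)) = ⟨g' j, e' j⟩) : homMk g hg e = homMk g' hg' e' :=
  UGerm.of_eq H

theorem homMk_comp {X Y Z : UltraFamily.{w} C} (g : Y.ι → X.ι) (hg : Y.uf.map g = X.uf)
    (e : ∀ j, X.obj (g j) ⟶ Y.obj j) (g' : Z.ι → Y.ι) (hg' : Z.uf.map g' = Y.uf)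
    (e' : ∀ j, Y.obj (g' j) ⟶ Z.obj j) :
    homMk g hg e ≫ homMk g' hg' e' = homMk (fun k => g (g' k))
      (by rw [← hg, ← hg', Ultrafilter.map_map]; rfl) (fun k => e (g' k) ≫ e' k) := rfl

theorem hom_ind {X Y : UltraFamily.{w} C} {p : (X ⟶ Y) → Prop} (h : ∀ g hg e, p (homMk g hg e))
    (f : X ⟶ Y) : p f := UGerm.ind h f

/-- The reindexing morphism `(X, h, ν) ⟶ (J, h ∘ g, ξ)` given by a function `g : J → X` which
pushes `ξ` to `ν`. -/
def reindex (X : UltraFamily.{w} C) {J : Type w} (g : J → X.ι) (ξ : Ultrafilter J)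
    (hg : ξ.map g = X.uf) : X ⟶ ⟨J, fun j => X.obj (g j), ξ⟩ :=
  homMk g hg fun j => 𝟙 (X.obj (g j))

variable (C) in
/-- The unit `η : C ⥤ β C`. -/
def unit : C ⥤ UltraFamily.{w} C where
  obj c := ⟨PUnit.{w+1}, fun _ => c, pure PUnit.unit⟩
  map f := homMk id (Ultrafilter.map_id _) fun _ => f
  map_id _ := rfl
  map_comp _ _ := rfl

/-- The action `β f` of `β` on a functor `f`. -/
def mapF (f : C ⥤ D) : UltraFamily.{w} C ⥤ UltraFamily.{w} D where
  obj X := ⟨X.ι, fun i => f.obj (X.obj i), X.uf⟩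
  map {X Y} φ := UGerm.map (E := fun i j => (X.obj i ⟶ Y.obj j))
    (E₁ := fun i j => (f.obj (X.obj i) ⟶ f.obj (Y.obj j))) (fun _ _ h => f.map h) φ
  map_id X := UGerm.of_congr (E := fun i j => (f.obj (X.obj i) ⟶ f.obj (X.obj j))) (g := id) fun j => f.map_id (X.obj j)
  map_comp φ ψ := by
    induction φ using hom_ind
    induction ψ using hom_ind
    rename_i X Y Z g hg e g' hg' e'
    exact UGerm.of_congr (E := fun i j => (f.obj (X.obj i) ⟶ f.obj (Z.obj j)))
      (g := fun j => g (g' j)) fun j => f.map_comp (e _) (e' j)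

theorem mapF_homMk (f : C ⥤ D) {X Y : UltraFamily.{w} C} (g : Y.ι → X.ι) (hg : Y.uf.map g = X.uf)
    (e : ∀ j, X.obj (g j) ⟶ Y.obj j) :
    (mapF f).map (homMk g hg e) =
      (homMk g hg (fun j => f.map (e j)) :
        (⟨X.ι, fun i => f.obj (X.obj i), X.uf⟩ : UltraFamily.{w} D) ⟶
          ⟨Y.ι, fun i => f.obj (Y.obj i), Y.uf⟩) := rfl

theorem hom_ind₂ {X Y : UltraFamily.{w} (UltraFamily.{w} C)} {p : (X ⟶ Y) → Prop}
    (h : ∀ (g : Y.ι → X.ι) (hg : Y.uf.map g = X.uf) (k : ∀ j, (Y.obj j).ι → (X.obj (g j)).ι)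
      (hk : ∀ j, (Y.obj j).uf.map (k j) = (X.obj (g j)).uf)
      (e : ∀ j b, (X.obj (g j)).obj (k j b) ⟶ (Y.obj j).obj b),
      p (homMk g hg fun j => homMk (k j) (hk j) (e j)))
    (f : X ⟶ Y) : p f := UGerm.ind₂ h f

/-- The action of the multiplication on morphisms: if `(g, e)` is a morphism of `β (β C)` and
`(k j, e' j)` represents `e j`, the result is represented by `(j, b) ↦ (g j, k j b)` and
the morphisms `e' j b`. -/
noncomputable def multMap {X Y : UltraFamily.{w} (UltraFamily.{w} C)} (φ : X ⟶ Y) :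
    (⟨Σ i, (X.obj i).ι, fun p => (X.obj p.1).obj p.2, sumU X.uf fun i => (X.obj i).uf⟩ :
      UltraFamily.{w} C) ⟶
    ⟨Σ i, (Y.obj i).ι, fun p => (Y.obj p.1).obj p.2, sumU Y.uf fun i => (Y.obj i).uf⟩ :=
  UGerm.sum (A := fun i => (X.obj i).ι) (B := fun j => (Y.obj j).ι)
    (lam := fun i => (X.obj i).uf) (kap := fun j => (Y.obj j).uf)
    (E := fun p q => ((X.obj p.1).obj p.2 ⟶ (Y.obj q.1).obj q.2)) φ

theorem multMap_homMk {X Y : UltraFamily.{w} (UltraFamily.{w} C)} (g : Y.ι → X.ι)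
    (hg : Y.uf.map g = X.uf) (k : ∀ j, (Y.obj j).ι → (X.obj (g j)).ι)
    (hk : ∀ j, (Y.obj j).uf.map (k j) = (X.obj (g j)).uf)
    (e : ∀ j b, (X.obj (g j)).obj (k j b) ⟶ (Y.obj j).obj b) :
    multMap (homMk g hg fun j => homMk (k j) (hk j) (e j)) =
      homMk (X := ⟨Σ i, (X.obj i).ι, fun p => (X.obj p.1).obj p.2, sumU X.uf fun i => (X.obj i).uf⟩)
        (Y := ⟨Σ i, (Y.obj i).ι, fun p => (Y.obj p.1).obj p.2, sumU Y.uf fun i => (Y.obj i).uf⟩)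
        (fun p => ⟨g p.1, k p.1 p.2⟩) (UGerm.sum_push hg hk) (fun p => e p.1 p.2) :=
  UGerm.sum_of (A := fun i => (X.obj i).ι) (B := fun j => (Y.obj j).ι)
    (lam := fun i => (X.obj i).uf) (kap := fun j => (Y.obj j).uf)
    (E := fun p q => ((X.obj p.1).obj p.2 ⟶ (Y.obj q.1).obj q.2)) g hg k hk e

variable (C) in
/-- The multiplication `μ : β (β C) ⥤ β C`, given by direct sums. -/
noncomputable def mult : UltraFamily.{w} (UltraFamily.{w} C) ⥤ UltraFamily.{w} C where
  obj X := ⟨Σ i, (X.obj i).ι, fun p => (X.obj p.1).obj p.2, sumU X.uf fun i => (X.obj i).uf⟩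
  map φ := multMap φ
  map_id X := multMap_homMk _ _ _ _ _
  map_comp {X Y Z} φ ψ := by
    induction φ using hom_ind₂
    induction ψ using hom_ind₂
    rename_i g hg k hk e g' hg' k' hk' e'
    rw [multMap_homMk, multMap_homMk]
    exact multMap_homMk _ _ _ _ _

theorem mult_homMk {X Y : UltraFamily.{w} (UltraFamily.{w} C)} (g : Y.ι → X.ι)
    (hg : Y.uf.map g = X.uf) (k : ∀ j, (Y.obj j).ι → (X.obj (g j)).ι)
    (hk : ∀ j, (Y.obj j).uf.map (k j) = (X.obj (g j)).uf)
    (e : ∀ j b, (X.obj (g j)).obj (k j b) ⟶ (Y.obj j).obj b) :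
    (mult C).map (homMk g hg fun j => homMk (k j) (hk j) (e j)) =
      homMk (X := (mult C).obj X) (Y := (mult C).obj Y)
        (fun p => ⟨g p.1, k p.1 p.2⟩) (UGerm.sum_push hg hk) (fun p => e p.1 p.2) :=
  multMap_homMk g hg k hk e

/-- The component `μ (η X) ⟶ X` of the left unit isomorphism of `β`. -/
noncomputable def lun (X : UltraFamily.{w} C) :
    (mult C).obj ((unit (UltraFamily.{w} C)).obj X) ⟶ X :=
  homMk (fun x => (⟨PUnit.unit, x⟩ : Σ _ : PUnit.{w+1}, X.ι)) rfl fun x => 𝟙 (X.obj x)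

/-- The component `μ ((β η) X) ⟶ X` of the right unit isomorphism of `β`. -/
noncomputable def run (X : UltraFamily.{w} C) :
    (mult C).obj ((mapF (unit C)).obj X) ⟶ X :=
  homMk (fun x => (⟨x, PUnit.unit⟩ : Σ _ : X.ι, PUnit.{w+1})) rfl fun x => 𝟙 (X.obj x)

/-- The component `μ ((β μ) X) ⟶ μ (μ X)` of the associativity isomorphism of `β`. -/
noncomputable def massoc (X : UltraFamily.{w} (UltraFamily.{w} (UltraFamily.{w} C))) :
    (mult C).obj ((mapF (mult C)).obj X) ⟶ (mult C).obj ((mult (UltraFamily.{w} C)).obj X) :=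
  homMk (fun p : Σ q : (Σ x, (X.obj x).ι), ((X.obj q.1).obj q.2).ι =>
    (⟨p.1.1, ⟨p.1.2, p.2⟩⟩ : Σ x, Σ y, ((X.obj x).obj y).ι)) rfl
    fun p => 𝟙 (((X.obj p.1.1).obj p.1.2).obj p.2)

end UltraFamily

end Ultracompletion

/-! ### Profunctors -/

section Profunctors

variable {C : Type u₁} [Category.{w} C] {D : Type u₂} [Category.{w} D]
  {E : Type u₃} [Category.{w} E]

/-- The set `P(d, c)` of elements of a profunctor `P` from `C` to `D`. -/
def El (P : Profunctor.{v} C D) (d : D) (c : C) : Type v := (P.obj c).obj (op d)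

/-- The contravariant action on the elements of a profunctor. -/
def lact {P : Profunctor.{v} C D} {d' d : D} {c : C} (h : d' ⟶ d) (p : El P d c) : El P d' c :=
  (P.obj c).map h.op p

/-- The covariant action on the elements of a profunctor. -/
def ract {P : Profunctor.{v} C D} {d : D} {c c' : C} (p : El P d c) (k : c ⟶ c') : El P d c' :=
  (P.map k).app (op d) p

section
variable {P : Profunctor.{v} C D}

@[simp] theorem lact_id {d : D} {c : C} (p : El P d c) : lact (𝟙 d) p = p := by
  simp [lact]; rfl

@[simp] theorem ract_id {d : D} {c : C} (p : El P d c) : ract p (𝟙 c) = p := by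
  simp [ract]; rfl

theorem lact_comp {d'' d' d : D} {c : C} (h' : d'' ⟶ d') (h : d' ⟶ d) (p : El P d c) :
    lact (h' ≫ h) p = lact h' (lact h p) := by
  simp [lact]; rfl

theorem ract_comp {d : D} {c c' c'' : C} (p : El P d c) (k : c ⟶ c') (k' : c' ⟶ c'') :
    ract p (k ≫ k') = ract (ract p k) k' := by
  simp [ract]; rfl

theorem lact_ract {d' d : D} {c c' : C} (h : d' ⟶ d) (p : El P d c) (k : c ⟶ c') :
    lact h (ract p k) = ract (lact h p) k := by
  simp only [lact, ract]
  exact (congrArg (fun m => m p) ((P.map k).naturality h.op)).symm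

end

/-- A profunctor from its sets of elements and its two commuting actions. -/
def mkProf (obj : D → C → Type v) (l : ∀ {d' d c}, (d' ⟶ d) → obj d c → obj d' c)
    (r : ∀ {d c c'}, obj d c → (c ⟶ c') → obj d c')
    (l_id : ∀ {d c} (p : obj d c), l (𝟙 d) p = p)
    (l_comp : ∀ {d'' d' d c} (h' : d'' ⟶ d') (h : d' ⟶ d) (p : obj d c),
      l (h' ≫ h) p = l h' (l h p))
    (r_id : ∀ {d c} (p : obj d c), r p (𝟙 c) = p)
    (r_comp : ∀ {d c c' c''} (p : obj d c) (k : c ⟶ c') (k' : c' ⟶ c''),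
      r p (k ≫ k') = r (r p k) k')
    (l_r : ∀ {d' d c c'} (h : d' ⟶ d) (p : obj d c) (k : c ⟶ c'), l h (r p k) = r (l h p) k) :
    Profunctor.{v} C D where
  obj c :=
    { obj := fun d => obj d.unop c
      map := fun h => ↾ (l h.unop)
      map_id := fun d => by ext p; exact l_id p
      map_comp := fun h h' => by ext p; exact l_comp h'.unop h.unop p }
  map k :=
    { app := fun d => ↾ (fun p => r p k)
      naturality := fun d d' h => by ext p; exact (l_r h.unop p k).symm }
  map_id c := by ext d p; exact r_id p
  map_comp k k' := by ext d p; exact r_comp p k k'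

/-- A `2`-cell between profunctors. -/
@[ext] structure TwoCell (P : Profunctor.{v₁} C D) (Q : Profunctor.{v₂} C D) where
  app : ∀ (d : D) (c : C), El P d c → El Q d c
  app_lact : ∀ {d' d : D} {c : C} (h : d' ⟶ d) (p : El P d c),
    app d' c (lact h p) = lact h (app d c p)
  app_ract : ∀ {d : D} {c c' : C} (p : El P d c) (k : c ⟶ c'),
    app d c' (ract p k) = ract (app d c p) k

/-- Vertical composition of `2`-cells. -/
def TwoCell.vcomp {P : Profunctor.{v₁} C D} {Q : Profunctor.{v₂} C D} {R : Profunctor.{v₃} C D}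
    (τ : TwoCell Q R) (σ : TwoCell P Q) : TwoCell P R where
  app d c p := τ.app d c (σ.app d c p)
  app_lact h p := by rw [σ.app_lact, τ.app_lact]
  app_ract p k := by rw [σ.app_ract, τ.app_ract]

section Composition

variable (G : Profunctor.{v₂} D E) (F : Profunctor.{v₁} C D)

/-- The relation `(q · h, p) ∼ (q, h · p)` whose quotient is the coend `∫ d, G(e, d) × F(d, c)`. -/
inductive PcompRel (e : E) (c : C) :
    (Σ d : D, El G e d × El F d c) → (Σ d : D, El G e d × El F d c) → Prop
  | intro {d d' : D} (q : El G e d) (h : d ⟶ d') (p : El F d' c) :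
      PcompRel e c ⟨d', ract q h, p⟩ ⟨d, q, lact h p⟩

variable {G F} in
/-- The class of a pair `(q, p)` in the composite profunctor. -/
def cmk {e : E} {c : C} {d : D} (q : El G e d) (p : El F d c) : Quot (PcompRel G F e c) :=
  Quot.mk _ ⟨d, q, p⟩

variable {G F} in
theorem cmk_sound {e : E} {c : C} {d d' : D} (q : El G e d) (h : d ⟶ d') (p : El F d' c) :
    cmk (ract q h) p = cmk q (lact h p) :=
  Quot.sound (.intro q h p)

/-- The composite `G ∘ F` of profunctors, `(G ∘ F)(e, c) = ∫ d, G(e, d) × F(d, c)`. -/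
def pcomp : Profunctor.{max u₂ v₁ v₂} C E :=
  mkProf (fun e c => Quot (PcompRel G F e c))
    (fun h => Quot.map (fun x => ⟨x.1, lact h x.2.1, x.2.2⟩) (by
      rintro _ _ ⟨q, k, p⟩
      rw [lact_ract]
      exact .intro (lact h q) k p))
    (fun x k => Quot.map (fun x => ⟨x.1, x.2.1, ract x.2.2 k⟩) (by
      rintro _ _ ⟨q, h, p⟩
      rw [← lact_ract]
      exact .intro q h (ract p k)) x)
    (by rintro e c ⟨d, q, p⟩; exact congrArg (Quot.mk _) (by simp))
    (by rintro e'' e' e c h' h ⟨d, q, p⟩; exact congrArg (Quot.mk _) (by simp [lact_comp]))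
    (by rintro e c ⟨d, q, p⟩; exact congrArg (Quot.mk _) (by simp))
    (by rintro e c c' c'' ⟨d, q, p⟩ k k'; exact congrArg (Quot.mk _) (by simp [ract_comp]))
    (by rintro e' e c c' h ⟨d, q, p⟩ k; rfl)

variable {G F}

theorem pcomp_ind {e : E} {c : C} {m : El (pcomp G F) e c → Prop}
    (h : ∀ (d : D) (q : El G e d) (p : El F d c), m (cmk q p)) (x : El (pcomp G F) e c) : m x :=
  Quot.ind (fun x => h x.1 x.2.1 x.2.2) x

theorem lact_cmk {e' e : E} {c : C} {d : D} (h : e' ⟶ e) (q : El G e d) (p : El F d c) :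
    lact (P := pcomp G F) h (cmk q p) = cmk (lact h q) p := rfl

theorem ract_cmk {e : E} {c c' : C} {d : D} (q : El G e d) (p : El F d c) (k : c ⟶ c') :
    ract (P := pcomp G F) (cmk q p) k = cmk q (ract p k) := rfl

/-- A `2`-cell out of a composite, from its values on pairs. -/
def TwoCell.ofPcomp {Q : Profunctor.{v₃} C E}
    (m : ∀ {e : E} {d : D} {c : C}, El G e d → El F d c → El Q e c)
    (bal : ∀ {e : E} {d d' : D} {c : C} (q : El G e d) (h : d ⟶ d') (p : El F d' c),
      m (ract q h) p = m q (lact h p))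
    (m_lact : ∀ {e' e : E} {d : D} {c : C} (h : e' ⟶ e) (q : El G e d) (p : El F d c),
      m (lact h q) p = lact h (m q p))
    (m_ract : ∀ {e : E} {d : D} {c c' : C} (q : El G e d) (p : El F d c) (k : c ⟶ c'),
      m q (ract p k) = ract (m q p) k) : TwoCell (pcomp G F) Q where
  app e c x := Quot.lift (fun x => m x.2.1 x.2.2) (by rintro _ _ ⟨q, h, p⟩; exact bal q h p) x
  app_lact h x := by
    induction x using pcomp_ind with | _ d q p
    exact m_lact h q p
  app_ract x k := by
    induction x using pcomp_ind with | _ d q p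
    exact m_ract q p k

/-- Whiskering `σ ∘ F` of a `2`-cell with a profunctor. -/
def TwoCell.whiskerRight {G' : Profunctor.{v₃} D E} (σ : TwoCell G G') (F : Profunctor.{v₁} C D) :
    TwoCell (pcomp G F) (pcomp G' F) :=
  TwoCell.ofPcomp (fun q p => cmk (σ.app _ _ q) p)
    (fun q h p => by rw [σ.app_ract]; exact cmk_sound _ _ _)
    (fun h q p => by rw [σ.app_lact]; rfl) (fun q p k => rfl)

/-- Whiskering `G ∘ σ` of a `2`-cell with a profunctor. -/
def TwoCell.whiskerLeft {F' : Profunctor.{v₃} C D} (G : Profunctor.{v₂} D E) (σ : TwoCell F F') :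
    TwoCell (pcomp G F) (pcomp G F') :=
  TwoCell.ofPcomp (fun q p => cmk q (σ.app _ _ p))
    (fun q h p => by rw [σ.app_lact]; exact cmk_sound _ _ _)
    (fun h q p => rfl) (fun q p k => by rw [σ.app_ract]; rfl)

end Composition

/-- A profunctor `P` from `C` to `D` is small if each presheaf `P(-, c)` is a small colimit of
representable presheaves. -/
def IsSmall (P : Profunctor.{w} C D) : Prop :=
  ∀ c : C, ∃ (J : Type w) (_ : SmallCategory J) (K : J ⥤ D)
    (s : Limits.Cocone (K ⋙ yoneda)), Nonempty (Limits.IsColimit s) ∧ Nonempty (s.pt ≅ P.obj c)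

end Profunctors

/-! ### The extension of `β` to profunctors -/

section Extension

variable {C : Type u₁} [Category.{w} C] {D : Type u₂} [Category.{w} D]
  {E : Type u₃} [Category.{w} E]

open UltraFamily

/-- The extension of `β` to profunctors: for `Y = (Y, d, ν)` and `X = (X, c, ξ)`, an element of
`(betaExt F)(Y, X)` is a function `g : X → Y` which pushes `ξ` to `ν`, with a family of
elements of `F(d (g x), c x)` for `x ∈ X`, up to equality `ξ`-almost everywhere. -/
def betaExt (F : Profunctor.{v} C D) : Profunctor.{max w v} (UltraFamily.{w} C) (UltraFamily.{w} D) :=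
  mkProf (fun Y X => UGerm Y.uf X.uf fun i j => El F (Y.obj i) (X.obj j))
    (fun {Y' Y X} h t => UGerm.comp (E := fun i j => (Y'.obj i ⟶ Y.obj j))
      (E' := fun i j => El F (Y.obj i) (X.obj j)) (F := fun i j => El F (Y'.obj i) (X.obj j))
      (fun _ _ _ h p => lact h p) h t)
    (fun {Y X X'} t k => UGerm.comp (E := fun i j => El F (Y.obj i) (X.obj j))
      (E' := fun i j => (X.obj i ⟶ X'.obj j)) (F := fun i j => El F (Y.obj i) (X'.obj j))
      (fun _ _ _ p k => ract p k) t k)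
    (fun {Y X} t => by
      induction t using UGerm.ind with | _ g hg e
      exact UGerm.of_congr (E := fun i j => El F (Y.obj i) (X.obj j)) (g := g)
        fun j => lact_id (e j))
    (fun {Y'' Y' Y X} h' h t => by
      induction t using UGerm.ind with | _ g hg e
      induction h using hom_ind with | _ k hk h
      induction h' using hom_ind with | _ k' hk' h'
      exact UGerm.of_congr (E := fun i j => El F (Y''.obj i) (X.obj j))
        (g := fun j => k' (k (g j))) fun j => lact_comp (h' _) (h _) (e j))
    (fun {Y X} t => by
      induction t using UGerm.ind with | _ g hg e
      exact UGerm.of_congr (E := fun i j => El F (Y.obj i) (X.obj j)) (g := g)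
        fun j => ract_id (e j))
    (fun {Y X X' X''} t h h' => by
      induction t using UGerm.ind with | _ g hg e
      induction h using hom_ind with | _ k hk h
      induction h' using hom_ind with | _ k' hk' h'
      exact UGerm.of_congr (E := fun i j => El F (Y.obj i) (X''.obj j))
        (g := fun j => g (k (k' j))) fun j => ract_comp (e _) (h _) (h' j))
    (fun {Y' Y X X'} h t h' => by
      induction t using UGerm.ind with | _ g hg e
      induction h using hom_ind with | _ k hk h
      induction h' using hom_ind with | _ k' hk' h'
      exact UGerm.of_congr (E := fun i j => El F (Y'.obj i) (X'.obj j))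
        (g := fun j => k (g (k' j))) fun j => lact_ract (h _) (e _) (h' j))

section

variable {F : Profunctor.{v} C D}

/-- Elements of the extension of a profunctor, from representatives. -/
def extMk {Y : UltraFamily.{w} D} {X : UltraFamily.{w} C} (g : X.ι → Y.ι)
    (hg : X.uf.map g = Y.uf) (e : ∀ j, El F (Y.obj (g j)) (X.obj j)) : El (betaExt F) Y X :=
  (UGerm.of g hg e : UGerm Y.uf X.uf fun i j => El F (Y.obj i) (X.obj j))

theorem ext_ind {Y : UltraFamily.{w} D} {X : UltraFamily.{w} C} {m : El (betaExt F) Y X → Prop}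
    (h : ∀ g hg e, m (extMk g hg e)) (t : El (betaExt F) Y X) : m t := UGerm.ind h t

theorem extMk_eq {Y : UltraFamily.{w} D} {X : UltraFamily.{w} C} {g g' : X.ι → Y.ι}
    {hg : X.uf.map g = Y.uf} {hg' : X.uf.map g' = Y.uf}
    {e : ∀ j, El F (Y.obj (g j)) (X.obj j)} {e' : ∀ j, El F (Y.obj (g' j)) (X.obj j)}
    (H : ∀ᶠ j in (X.uf : Filter X.ι),
      (⟨g j, e j⟩ : Σ i, El F (Y.obj i) (X.obj j)) = ⟨g' j, e' j⟩) :
    extMk g hg e = extMk g' hg' e' := UGerm.of_eq H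

theorem extMk_eq_iff {Y : UltraFamily.{w} D} {X : UltraFamily.{w} C} {g g' : X.ι → Y.ι}
    {hg : X.uf.map g = Y.uf} {hg' : X.uf.map g' = Y.uf}
    {e : ∀ j, El F (Y.obj (g j)) (X.obj j)} {e' : ∀ j, El F (Y.obj (g' j)) (X.obj j)} :
    extMk g hg e = extMk g' hg' e' ↔ ∀ᶠ j in (X.uf : Filter X.ι),
      (⟨g j, e j⟩ : Σ i, El F (Y.obj i) (X.obj j)) = ⟨g' j, e' j⟩ := UGerm.of_eq_iff

theorem extMk_congr {Y : UltraFamily.{w} D} {X : UltraFamily.{w} C} {g : X.ι → Y.ι}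
    {hg : X.uf.map g = Y.uf} {e e' : ∀ j, El F (Y.obj (g j)) (X.obj j)} (H : ∀ j, e j = e' j) :
    extMk g hg e = extMk g hg e' := by rw [funext H]

theorem lact_extMk {Y Y' : UltraFamily.{w} D} {X : UltraFamily.{w} C} (k : Y.ι → Y'.ι)
    (hk : Y.uf.map k = Y'.uf) (h : ∀ j, Y'.obj (k j) ⟶ Y.obj j) (g : X.ι → Y.ι)
    (hg : X.uf.map g = Y.uf) (e : ∀ j, El F (Y.obj (g j)) (X.obj j)) :
    lact (homMk k hk h) (extMk g hg e) = extMk (fun j => k (g j))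
      (by rw [← hk, ← hg, Ultrafilter.map_map]; rfl) (fun j => lact (h (g j)) (e j)) := rfl

theorem ract_extMk {Y : UltraFamily.{w} D} {X X' : UltraFamily.{w} C} (g : X.ι → Y.ι)
    (hg : X.uf.map g = Y.uf) (e : ∀ j, El F (Y.obj (g j)) (X.obj j)) (k : X'.ι → X.ι)
    (hk : X'.uf.map k = X.uf) (h : ∀ j, X.obj (k j) ⟶ X'.obj j) :
    ract (extMk g hg e) (homMk k hk h) = extMk (fun j => g (k j))
      (by rw [← hg, ← hk, Ultrafilter.map_map]; rfl) (fun j => ract (e (k j)) (h j)) := rfl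

end

/-- The action of the extension on `2`-cells. -/
def TwoCell.betaExt {P : Profunctor.{v₁} C D} {Q : Profunctor.{v₂} C D} (σ : TwoCell P Q) :
    TwoCell (betaExt P) (UltraConv.betaExt Q) where
  app Y X t := UGerm.map (E := fun i j => El P (Y.obj i) (X.obj j))
    (E₁ := fun i j => El Q (Y.obj i) (X.obj j)) (fun _ _ p => σ.app _ _ p) t
  app_lact {Y' Y X} h t := by
    induction t using ext_ind with | _ g hg e
    induction h using hom_ind with | _ k hk h
    exact extMk_congr (F := Q) (Y := Y') (X := X) (g := fun j => k (g j))
      fun j => σ.app_lact (h _) (e j)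
  app_ract {Y X X'} t h := by
    induction t using ext_ind with | _ g hg e
    induction h using hom_ind with | _ k hk h
    exact extMk_congr (F := Q) (Y := Y) (X := X') (g := fun j => g (k j))
      fun j => σ.app_ract (e _) (h j)

theorem TwoCell.ext_extMk {P : Profunctor.{v₁} C D} {Q : Profunctor.{v₂} C D} (σ : TwoCell P Q) {Y : UltraFamily.{w} D}
    {X : UltraFamily.{w} C} (g : X.ι → Y.ι) (hg : X.uf.map g = Y.uf)
    (e : ∀ j, El P (Y.obj (g j)) (X.obj j)) :
    σ.betaExt.app Y X (extMk g hg e) = extMk g hg (fun j => σ.app _ _ (e j)) := rfl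

/-- The canonical `2`-cell `β G ∘ β F ⇒ β (G ∘ F)`. -/
def laxComp (G : Profunctor.{v₂} D E) (F : Profunctor.{v₁} C D) :
    TwoCell (pcomp (betaExt G) (betaExt F)) (betaExt (pcomp G F)) :=
  TwoCell.ofPcomp
    (fun {Z Y X} s t => UGerm.comp (E := fun i j => El G (Z.obj i) (Y.obj j))
      (E' := fun i j => El F (Y.obj i) (X.obj j)) (F := fun i j => El (pcomp G F) (Z.obj i) (X.obj j))
      (fun _ _ _ q p => cmk q p) s t)
    (fun {Z Y' Y X} s h t => by
      induction s using ext_ind with | _ g hg e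
      induction h using hom_ind with | _ k hk h
      induction t using ext_ind with | _ g' hg' e'
      exact extMk_congr (F := pcomp G F) (Y := Z) (X := X) (g := fun j => g (k (g' j)))
        fun j => cmk_sound (e _) (h _) (e' j))
    (fun {Z' Z Y X} h s t => by
      induction s using ext_ind with | _ g hg e
      induction h using hom_ind with | _ k hk h
      induction t using ext_ind with | _ g' hg' e'
      rfl)
    (fun {Z Y X X'} s t h => by
      induction s using ext_ind with | _ g hg e
      induction h using hom_ind with | _ k hk h
      induction t using ext_ind with | _ g' hg' e'
      rfl)

theorem laxComp_extMk {G : Profunctor.{v₂} D E} {F : Profunctor.{v₁} C D}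
    {Z : UltraFamily.{w} E} {Y : UltraFamily.{w} D} {X : UltraFamily.{w} C}
    (g : Y.ι → Z.ι) (hg : Y.uf.map g = Z.uf) (e : ∀ j, El G (Z.obj (g j)) (Y.obj j))
    (g' : X.ι → Y.ι) (hg' : X.uf.map g' = Y.uf) (e' : ∀ j, El F (Y.obj (g' j)) (X.obj j)) :
    (laxComp G F).app Z X (cmk (extMk g hg e) (extMk g' hg' e')) =
      extMk (F := pcomp G F) (fun j => g (g' j)) (by rw [← hg, ← hg', Ultrafilter.map_map]; rfl)
        (fun j => cmk (e (g' j)) (e' j)) := rfl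

/-- The naturality `2`-cell of the unit `η` at a profunctor, on elements. -/
def unitCell {F : Profunctor.{v} C D} {d : D} {c : C} (p : El F d c) :
    El (betaExt F) ((unit D).obj d) ((unit C).obj c) :=
  extMk (X := (unit C).obj c) (Y := (unit D).obj d) id (Ultrafilter.map_id _) fun _ => p

/-- The naturality `2`-cell of the multiplication `μ` at a profunctor, on elements. -/
noncomputable def multCell {F : Profunctor.{v} C D} {Y : UltraFamily.{w} (UltraFamily.{w} D)}
    {X : UltraFamily.{w} (UltraFamily.{w} C)} (T : El (betaExt (betaExt F)) Y X) :
    El (betaExt F) ((mult D).obj Y) ((mult C).obj X) :=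
  UGerm.sum (A := fun i => (Y.obj i).ι) (B := fun j => (X.obj j).ι)
    (lam := fun i => (Y.obj i).uf) (kap := fun j => (X.obj j).uf)
    (E := fun p q => El F ((Y.obj p.1).obj p.2) ((X.obj q.1).obj q.2)) T

theorem multCell_extMk {F : Profunctor.{v} C D} {Y : UltraFamily.{w} (UltraFamily.{w} D)}
    {X : UltraFamily.{w} (UltraFamily.{w} C)} (g : X.ι → Y.ι)
    (hg : X.uf.map g = Y.uf) (k : ∀ j, (X.obj j).ι → (Y.obj (g j)).ι)
    (hk : ∀ j, (X.obj j).uf.map (k j) = (Y.obj (g j)).uf)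
    (e : ∀ j b, El F ((Y.obj (g j)).obj (k j b)) ((X.obj j).obj b)) :
    multCell (extMk (F := betaExt F) g hg fun j => extMk (k j) (hk j) (e j)) =
      extMk (F := F) (Y := (mult D).obj Y) (X := (mult C).obj X)
        (fun p => ⟨g p.1, k p.1 p.2⟩) (UGerm.sum_push hg hk) (fun p => e p.1 p.2) :=
  UGerm.sum_of (A := fun i => (Y.obj i).ι) (B := fun j => (X.obj j).ι)
    (lam := fun i => (Y.obj i).uf) (kap := fun j => (X.obj j).uf)
    (E := fun p q => El F ((Y.obj p.1).obj p.2) ((X.obj q.1).obj q.2)) g hg k hk e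

theorem ext_ind₂ {F : Profunctor.{v} C D} {Y : UltraFamily.{w} (UltraFamily.{w} D)}
    {X : UltraFamily.{w} (UltraFamily.{w} C)} {m : El (betaExt (betaExt F)) Y X → Prop}
    (h : ∀ (g : X.ι → Y.ι) (hg : X.uf.map g = Y.uf) (k : ∀ j, (X.obj j).ι → (Y.obj (g j)).ι)
      (hk : ∀ j, (X.obj j).uf.map (k j) = (Y.obj (g j)).uf)
      (e : ∀ j b, El F ((Y.obj (g j)).obj (k j b)) ((X.obj j).obj b)),
      m (extMk (F := betaExt F) g hg fun j => extMk (k j) (hk j) (e j)))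
    (T : El (betaExt (betaExt F)) Y X) : m T := UGerm.ind₂ h T

end Extension

section Total

open UltraFamily

variable {C : Type u₁} [Category.{w} C] {D : Type u₂} [Category.{w} D]

/-- The category of elements of a profunctor, i.e. the corresponding two-sided discrete fibration:
its objects are the elements `p ∈ F(d, c)`. -/
structure Total (F : Profunctor.{w} C D) where
  dom : D
  cod : C
  el : El F dom cod

/-- A morphism from `p` to `q` is a pair `(h, k)` with `h · q = p · k`. -/
@[ext] structure Total.Hom {F : Profunctor.{w} C D} (x y : Total F) : Type w where
  dom : x.dom ⟶ y.dom
  cod : x.cod ⟶ y.cod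
  comm : lact dom y.el = ract x.el cod

@[simps] instance Total.category (F : Profunctor.{w} C D) : Category.{w} (Total F) where
  Hom x y := Total.Hom x y
  id x := ⟨𝟙 _, 𝟙 _, by rw [lact_id, ract_id]⟩
  comp f g := ⟨f.dom ≫ g.dom, f.cod ≫ g.cod, by
    rw [lact_comp, g.comm, lact_ract, f.comm, ract_comp]⟩

/-- The projection `dom`. -/
def Total.domF (F : Profunctor.{w} C D) : Total F ⥤ D where
  obj x := x.dom
  map f := f.dom

/-- The projection `cod`. -/
def Total.codF (F : Profunctor.{w} C D) : Total F ⥤ C where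
  obj x := x.cod
  map f := f.cod

variable (F : Profunctor.{w} C D)

/-- The composite `(β dom)_⋄ ∘ (β cod)^⋄` for the two-sided discrete fibration of `F`. -/
abbrev spanExt : Profunctor (UltraFamily.{w} C) (UltraFamily.{w} D) :=
  pcomp (mapF (Total.domF F)).toProfunctor (mapF (Total.codF F)).toProfunctorRev

/-- The tautological element attached to an ultrafamily of elements of a profunctor. -/
def taut (Z : UltraFamily.{w} (Total F)) :
    El (betaExt F) ((mapF (Total.domF F)).obj Z) ((mapF (Total.codF F)).obj Z) :=
  extMk (Y := (mapF (Total.domF F)).obj Z) (X := (mapF (Total.codF F)).obj Z) id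
    (Ultrafilter.map_id _) fun z => (Z.obj z).el

/-- The canonical comparison from `(β dom)_⋄ ∘ (β cod)^⋄` to `betaExt F`. -/
def spanToExt : TwoCell (spanExt F) (betaExt F) :=
  TwoCell.ofPcomp
    (fun {Y Z X} l χ => ract (lact (show Y ⟶ (mapF (Total.domF F)).obj Z from l) (taut F Z))
      (show (mapF (Total.codF F)).obj Z ⟶ X from χ))
    (fun {Y Z Z' X} l m χ => by
      have key : lact ((mapF (Total.domF F)).map m) (taut F Z') =
          ract (taut F Z) ((mapF (Total.codF F)).map m) := by
        induction m using hom_ind with | _ g hg e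
        exact extMk_congr (F := F) (Y := (mapF (Total.domF F)).obj Z)
          (X := (mapF (Total.codF F)).obj Z') (g := g) fun j => (e j).comm
      change Y ⟶ (mapF (Total.domF F)).obj Z at l
      change (mapF (Total.codF F)).obj Z' ⟶ X at χ
      change ract (lact (l ≫ (mapF (Total.domF F)).map m) _) χ =
        ract (lact l _) ((mapF (Total.codF F)).map m ≫ χ)
      rw [lact_comp, key, ract_comp, lact_ract])
    (fun h l χ => by
      rw [lact_ract]
      exact congrArg (fun x => ract (P := betaExt F) x _) (lact_comp (P := betaExt F) h _ _))
    (fun l χ k => ract_comp (P := betaExt F) _ _ k)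

/-- The ultrafamily of elements attached to a representative of an element of `betaExt F`. -/
def repFam {Y : UltraFamily.{w} D} {X : UltraFamily.{w} C} (g : X.ι → Y.ι)
    (e : ∀ j, El F (Y.obj (g j)) (X.obj j)) : UltraFamily.{w} (Total F) :=
  ⟨X.ι, fun j => ⟨Y.obj (g j), X.obj j, e j⟩, X.uf⟩

/-- The class in `(β dom)_⋄ ∘ (β cod)^⋄` attached to a representative of an element of
`betaExt F`. -/
def repSpan {Y : UltraFamily.{w} D} {X : UltraFamily.{w} C} (g : X.ι → Y.ι)
    (hg : X.uf.map g = Y.uf) (e : ∀ j, El F (Y.obj (g j)) (X.obj j)) : El (spanExt F) Y X :=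
  cmk (G := (mapF (Total.domF F)).toProfunctor) (F := (mapF (Total.codF F)).toProfunctorRev)
    (d := repFam F g e) (reindex Y g X.uf hg) (𝟙 X)

theorem spanToExt_repSpan {Y : UltraFamily.{w} D} {X : UltraFamily.{w} C} (g : X.ι → Y.ι)
    (hg : X.uf.map g = Y.uf) (e : ∀ j, El F (Y.obj (g j)) (X.obj j)) :
    (spanToExt F).app Y X (repSpan F g hg e) = extMk g hg e :=
  extMk_congr fun j => (ract_id _).trans (lact_id (e j))

theorem repSpan_eq {Y : UltraFamily.{w} D} {X : UltraFamily.{w} C} {g g' : X.ι → Y.ι}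
    {hg : X.uf.map g = Y.uf} {hg' : X.uf.map g' = Y.uf} {e : ∀ j, El F (Y.obj (g j)) (X.obj j)}
    {e' : ∀ j, El F (Y.obj (g' j)) (X.obj j)}
    (H : ∀ᶠ j in (X.uf : Filter X.ι),
      (⟨g j, e j⟩ : Σ i, El F (Y.obj i) (X.obj j)) = ⟨g' j, e' j⟩) :
    repSpan F g hg e = repSpan F g' hg' e' := by
  let P : Type w := Σ j : X.ι, Σ i : Y.ι, El F (Y.obj i) (X.obj j)
  let φ : X.ι → P := fun j => ⟨j, g j, e j⟩
  let W : UltraFamily.{w} (Total F) :=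
    ⟨P, fun p => ⟨Y.obj p.2.1, X.obj p.1, p.2.2⟩, X.uf.map φ⟩
  let l : Y ⟶ (mapF (Total.domF F)).obj W :=
    reindex Y (fun p : P => p.2.1) (X.uf.map φ) (by rw [Ultrafilter.map_map]; exact hg)
  have key : ∀ (g₁ : X.ι → Y.ι) (hg₁ : X.uf.map g₁ = Y.uf)
      (e₁ : ∀ j, El F (Y.obj (g₁ j)) (X.obj j))
      (h₁ : X.uf.map (fun j => (⟨j, g₁ j, e₁ j⟩ : P)) = X.uf.map φ),
      repSpan F g₁ hg₁ e₁ = cmk (G := (mapF (Total.domF F)).toProfunctor)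
        (F := (mapF (Total.codF F)).toProfunctorRev) (d := W) l
        (show (mapF (Total.codF F)).obj W ⟶ X from
          reindex ((mapF (Total.codF F)).obj W) (fun j => (⟨j, g₁ j, e₁ j⟩ : P)) X.uf h₁) := by
    intro g₁ hg₁ e₁ h₁
    let m : W ⟶ repFam F g₁ e₁ := reindex W (fun j => (⟨j, g₁ j, e₁ j⟩ : P)) X.uf h₁
    have hm := cmk_sound (G := (mapF (Total.domF F)).toProfunctor)
      (F := (mapF (Total.codF F)).toProfunctorRev) (c := X) l m (𝟙 X)
    refine Eq.trans ?_ (hm.trans ?_)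
    · refine congrArg (fun q => cmk (G := (mapF (Total.domF F)).toProfunctor)
        (F := (mapF (Total.codF F)).toProfunctorRev) (d := repFam F g₁ e₁) q (𝟙 X)) ?_
      exact homMk_eq (X := Y) (Y := (mapF (Total.domF F)).obj (repFam F g₁ e₁))
        (Filter.Eventually.of_forall fun j => congrArg (Sigma.mk _) (Category.comp_id _).symm)
    · exact congrArg (cmk (G := (mapF (Total.domF F)).toProfunctor)
        (F := (mapF (Total.codF F)).toProfunctorRev) (d := W) l)
        (Category.comp_id ((mapF (Total.codF F)).map m))
  have hφ : X.uf.map (fun j => (⟨j, g' j, e' j⟩ : P)) = X.uf.map φ := by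
    apply ultrafilter_ext
    intro p
    change (∀ᶠ j in (X.uf : Filter X.ι), p ⟨j, g' j, e' j⟩) ↔
      ∀ᶠ j in (X.uf : Filter X.ι), p ⟨j, g j, e j⟩
    refine Filter.eventually_congr (H.mono fun j hj => ?_)
    rw [hj]
  rw [key g hg e rfl, key g' hg' e' hφ]
  refine congrArg (cmk (G := (mapF (Total.domF F)).toProfunctor)
    (F := (mapF (Total.codF F)).toProfunctorRev) (d := W) l) ?_
  exact homMk_eq (X := (mapF (Total.codF F)).obj W) (Y := X) (H.mono fun j hj =>
    congrArg (fun q : Σ i, El F (Y.obj i) (X.obj j) =>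
      (⟨⟨j, q⟩, 𝟙 (X.obj j)⟩ : Σ p : P, (X.obj p.1 ⟶ X.obj j))) hj)

theorem exists_repSpan {Y : UltraFamily.{w} D} {X : UltraFamily.{w} C} (x : El (spanExt F) Y X) :
    ∃ g hg e, x = repSpan F (Y := Y) (X := X) g hg e := by
  induction x using pcomp_ind with | _ Z l χ
  change Y ⟶ (mapF (Total.domF F)).obj Z at l
  change (mapF (Total.codF F)).obj Z ⟶ X at χ
  induction l using hom_ind with | _ g hg l
  induction χ using hom_ind with | _ k hk χ
  change ∀ z, Y.obj (g z) ⟶ (Z.obj z).dom at l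
  change X.ι → Z.ι at k
  change ∀ j, (Z.obj (k j)).cod ⟶ X.obj j at χ
  have hgk : X.uf.map (fun j => g (k j)) = Y.uf :=
    (Ultrafilter.map_map X.uf k g).symm.trans ((congrArg _ hk).trans hg)
  let Z₁ : UltraFamily.{w} (Total F) :=
    ⟨X.ι, fun j => ⟨(Z.obj (k j)).dom, X.obj j, ract (Z.obj (k j)).el (χ j)⟩, X.uf⟩
  let m₁ : Z ⟶ Z₁ := homMk (X := Z) (Y := Z₁) k hk fun j => ⟨𝟙 _, χ j, lact_id _⟩
  let e : ∀ j, El F (Y.obj (g (k j))) (X.obj j) :=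
    fun j => lact (l (k j)) (ract (Z.obj (k j)).el (χ j))
  let m₂ : repFam F (fun j => g (k j)) e ⟶ Z₁ :=
    homMk (X := repFam F (fun j => g (k j)) e) (Y := Z₁) id (Ultrafilter.map_id _)
      fun j => ⟨l (k j), 𝟙 _, (ract_id _).symm⟩
  refine ⟨fun j => g (k j), hgk, e, ?_⟩
  have h₁ := cmk_sound (G := (mapF (Total.domF F)).toProfunctor)
    (F := (mapF (Total.codF F)).toProfunctorRev) (c := X)
    (show El (mapF (Total.domF F)).toProfunctor Y Z from
      homMk (X := Y) (Y := (mapF (Total.domF F)).obj Z) g hg l) m₁ (𝟙 X)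
  have h₂ := cmk_sound (G := (mapF (Total.domF F)).toProfunctor)
    (F := (mapF (Total.codF F)).toProfunctorRev) (c := X)
    (show El (mapF (Total.domF F)).toProfunctor Y (repFam F (fun j => g (k j)) e) from
      reindex Y (fun j => g (k j)) X.uf hgk) m₂ (𝟙 X)
  refine Eq.trans ?_ (h₁.symm.trans (Eq.trans ?_ (h₂.trans ?_)))
  · refine congrArg (cmk (G := (mapF (Total.domF F)).toProfunctor)
      (F := (mapF (Total.codF F)).toProfunctorRev) _) ?_
    exact (Category.comp_id ((mapF (Total.codF F)).map m₁)).symm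
  · refine congrArg (fun q => cmk (G := (mapF (Total.domF F)).toProfunctor)
      (F := (mapF (Total.codF F)).toProfunctorRev) (d := Z₁) q (𝟙 X)) ?_
    exact homMk_eq (X := Y) (Y := (mapF (Total.domF F)).obj Z₁)
      (Filter.Eventually.of_forall fun j => congrArg (Sigma.mk (g (k j)))
        ((Category.comp_id (l (k j))).trans (Category.id_comp (l (k j))).symm))
  · refine congrArg (cmk (G := (mapF (Total.domF F)).toProfunctor)
      (F := (mapF (Total.codF F)).toProfunctorRev) _) ?_
    exact (Category.comp_id ((mapF (Total.codF F)).map m₂)).trans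
      ((mapF (Total.codF F)).map_id (repFam F (fun j => g (k j)) e))

/-- `betaExt F` is the composite `(β dom)_⋄ ∘ (β cod)^⋄`. -/
theorem bijective_spanToExt (Y : UltraFamily.{w} D) (X : UltraFamily.{w} C) :
    Function.Bijective ((spanToExt F).app Y X) := by
  constructor
  · intro x x' h
    obtain ⟨g, hg, e, rfl⟩ := exists_repSpan F x
    obtain ⟨g', hg', e', rfl⟩ := exists_repSpan F x'
    rw [spanToExt_repSpan, spanToExt_repSpan] at h
    exact repSpan_eq F (extMk_eq_iff.1 h)
  · intro t
    induction t using ext_ind with | _ g hg e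
    exact ⟨repSpan F g hg e, spanToExt_repSpan F g hg e⟩

end Total

open UltraFamily

/-! ### Lax algebras, colax morphisms and algebra `2`-cells -/

/-- A lax algebra, on the category `C`, for the extension of the pseudomonad `β` to the bicategory
of small profunctors. Composites with a representable profunctor `f_⋄` on the right are written as
restrictions `f ⋙ P`, and equations of pasted `2`-cells are written on elements: the components of
`unitCell`, `multCell`, `laxComp` and `lun`, `run`, `massoc` are those of the structure `2`-cells
of the pseudomonad. -/
structure LaxAlgebra (C : Type u) [Category.{w} C] where
  /-- the structure profunctor `β C ⇸ C` -/
  str : Profunctor.{w} (UltraFamily.{w} C) C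
  small : IsSmall str
  /-- the unit `1 ⇒ str ∘ η_⋄` -/
  Γ : TwoCell (Profunctor.id (C := C)) (unit C ⋙ str)
  /-- the multiplication `str ∘ β str ⇒ str ∘ μ_⋄` -/
  Δ : TwoCell (pcomp str (betaExt str)) (mult C ⋙ str)
  /-- `Δ` after `Γ` on the outside is the identity, modulo `μ ∘ η ≅ 1`. -/
  left_unit : ∀ (a : C) (X : UltraFamily.{w} C) (r : El str a X),
    ract (P := str) (Δ.app a ((unit (UltraFamily.{w} C)).obj X)
      (cmk (show El str a ((unit C).obj a) from Γ.app a a (𝟙 a)) (unitCell r))) (lun X) = r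
  /-- `Δ` after `β Γ` on the inside is the identity, modulo `μ ∘ β η ≅ 1`. -/
  right_unit : ∀ (a : C) (X : UltraFamily.{w} C) (r : El str a X),
    ract (P := str) (Δ.app a ((mapF (unit C)).obj X)
      (cmk r (show El (betaExt str) X ((mapF (unit C)).obj X) from
        Γ.betaExt.app X X (𝟙 X)))) (run X) = r
  /-- the two composites `str ∘ β str ∘ β β str ⇒ str ∘ μ_⋄ ∘ μ_⋄` agree, modulo
  `μ ∘ β μ ≅ μ ∘ μ` -/
  assoc : ∀ (a : C) (X : UltraFamily.{w} C) (Y : UltraFamily.{w} (UltraFamily.{w} C))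
    (Z : UltraFamily.{w} (UltraFamily.{w} (UltraFamily.{w} C)))
    (r : El str a X) (t : El (betaExt str) X Y) (T : El (betaExt (betaExt str)) Y Z),
    Δ.app a ((mult (UltraFamily.{w} C)).obj Z)
        (cmk (show El str a ((mult C).obj Y) from Δ.app a Y (cmk r t)) (multCell T)) =
      ract (P := str) (Δ.app a ((mapF (mult C)).obj Z)
        (cmk r (show El (betaExt str) X ((mapF (mult C)).obj Z) from
          Δ.betaExt.app X Z ((laxComp str (betaExt str)).app X Z (cmk t T))))) (massoc Z)

section Morphisms

variable {C : Type u₁} [Category.{w} C] {D : Type u₂} [Category.{w} D]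

/-- A representable colax morphism of lax algebras: a colax morphism whose underlying profunctor is
`f_⋄` for a functor `f`, where `f_⋄(d, c) = Hom(d, f c)`. The profunctor `β (f_⋄)` is `(β f)_⋄`, and
composition with it is restriction along `β f`. -/
structure ColaxMorphism (A : LaxAlgebra.{w} C) (B : LaxAlgebra.{w} D) where
  /-- the underlying functor -/
  functor : C ⥤ D
  /-- the structure `2`-cell `f_⋄ ∘ A ⇒ B ∘ (β f)_⋄` -/
  Θ : TwoCell (pcomp functor.toProfunctor A.str) (mapF functor ⋙ B.str)
  unit_comp : ∀ (d : D) (c : C) (h : El functor.toProfunctor d c),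
    Θ.app d ((unit C).obj c) (cmk h (show El A.str c ((unit C).obj c) from A.Γ.app c c (𝟙 c))) =
      B.Γ.app d (functor.obj c) h
  mult_comp : ∀ (d : D) (c : C) (X : UltraFamily.{w} C) (Y : UltraFamily.{w} (UltraFamily.{w} C))
    (h : El functor.toProfunctor d c) (r : El A.str c X) (t : El (betaExt A.str) X Y),
    Θ.app d ((mult C).obj Y)
        (cmk h (show El A.str c ((mult C).obj Y) from A.Δ.app c Y (cmk r t))) =
      B.Δ.app d ((mapF (mapF functor)).obj Y)
        (cmk (show El B.str d ((mapF functor).obj X) from Θ.app d X (cmk h r))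
          (show El (betaExt B.str) ((mapF functor).obj X) ((mapF (mapF functor)).obj Y) from
            Θ.betaExt.app ((mapF functor).obj X) Y
              ((laxComp functor.toProfunctor A.str).app ((mapF functor).obj X) Y
                (cmk (show El (betaExt functor.toProfunctor) ((mapF functor).obj X) X from
                  𝟙 ((mapF functor).obj X)) t))))

/-- The isomorphism `B ∘ (β f)_⋄ ≅ B ∘ β (f_⋄)`. -/
def reprCell (Q : Profunctor.{w} (UltraFamily.{w} D) D) (f : C ⥤ D) :
    TwoCell (mapF f ⋙ Q) (pcomp Q (betaExt f.toProfunctor)) where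
  app d X q := cmk (show El Q d ((mapF f).obj X) from q)
    (show El (betaExt f.toProfunctor) ((mapF f).obj X) X from 𝟙 ((mapF f).obj X))
  app_lact h q := rfl
  app_ract {d X X'} q k := by
    have key : lact (P := betaExt f.toProfunctor) ((mapF f).map k)
        (show El (betaExt f.toProfunctor) ((mapF f).obj X') X' from 𝟙 ((mapF f).obj X')) =
        ract (show El (betaExt f.toProfunctor) ((mapF f).obj X) X from 𝟙 ((mapF f).obj X)) k := by
      induction k using hom_ind with | _ g hg e
      refine extMk_congr (F := f.toProfunctor) (Y := (mapF f).obj X) (X := X') (g := g)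
        fun j => ?_
      change f.map (e j) ≫ 𝟙 _ = 𝟙 _ ≫ f.map (e j)
      rw [Category.comp_id, Category.id_comp]
    exact (cmk_sound (G := Q) (F := betaExt f.toProfunctor) q ((mapF f).map k) _).trans
      (congrArg (cmk (G := Q) (F := betaExt f.toProfunctor) q) key)

/-- An algebra `2`-cell between (representable) colax morphisms: a `2`-cell `σ : f_⋄ ⇒ g_⋄` of
profunctors which is compatible with the structure `2`-cells. -/
structure AlgebraTwoCell {A : LaxAlgebra.{w} C} {B : LaxAlgebra.{w} D} (F G : ColaxMorphism A B)
    where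
  cell : TwoCell F.functor.toProfunctor G.functor.toProfunctor
  comm : (TwoCell.whiskerLeft B.str cell.betaExt).vcomp ((reprCell B.str F.functor).vcomp F.Θ) =
    (reprCell B.str G.functor).vcomp (G.Θ.vcomp (cell.whiskerRight A.str))

end Morphisms

/-! ### Ultraconvergence spaces -/

/-- An ultraconvergence space: a discrete category with an ultraconvergence structure. -/
structure UltraconvergenceSpace where
  /-- the discrete category of points -/
  Pt : Type u
  [category : Category.{w} Pt]
  [discrete : IsDiscrete Pt]
  /-- the profunctor of ultraconvergence arrows -/
  conv : Profunctor.{w} (UltraFamily.{w} Pt) Pt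
  small : IsSmall conv
  /-- the identity ultraconvergence arrows -/
  idArrow : ∀ a : Pt, El conv a ((unit Pt).obj a)
  /-- the composite of `r` and the ultrafamily `s`, in this order -/
  comp : ∀ {a : Pt} {X : UltraFamily.{w} Pt} (r : El conv a X) {c : X.ι → UltraFamily.{w} Pt}
    (s : ∀ x, El conv (X.obj x) (c x)), El conv a ((mult Pt).obj ⟨X.ι, c, X.uf⟩)
  /-- `(s_{g y})_y · r[g] = ((s_x)_x · r)[g ⊗ id]` -/
  left_naturality : ∀ {a : Pt} {X : UltraFamily.{w} Pt} (r : El conv a X)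
    {c : X.ι → UltraFamily.{w} Pt} (s : ∀ x, El conv (X.obj x) (c x))
    {J : Type w} (g : J → X.ι) (ξ : Ultrafilter J) (hg : ξ.map g = X.uf),
    comp (ract r (reindex X g ξ hg)) (fun y => s (g y)) =
      ract (comp r s) ((mult Pt).map (reindex ⟨X.ι, c, X.uf⟩ g ξ hg))
  /-- `(s_x[g_x])_x · r = ((s_x)_x · r)[id ⊗ (g_x)_x]` -/
  right_naturality : ∀ {a : Pt} {X : UltraFamily.{w} Pt} (r : El conv a X)
    {c d : X.ι → UltraFamily.{w} Pt} (s : ∀ x, El conv (X.obj x) (c x)) (g : ∀ x, c x ⟶ d x),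
    comp r (fun x => ract (s x) (g x)) =
      ract (comp r s) ((mult Pt).map (X := ⟨X.ι, c, X.uf⟩) (Y := ⟨X.ι, d, X.uf⟩)
        (homMk id (Ultrafilter.map_id _) g))
  /-- `(r)_* · id_a = r`, modulo the unit isomorphism of `β` -/
  left_unit : ∀ {a : Pt} {X : UltraFamily.{w} Pt} (r : El conv a X),
    ract (comp (idArrow a) (fun _ => r)) (lun X) = r
  /-- `(id_{b_x})_x · r = r`, modulo the unit isomorphism of `β` -/
  right_unit : ∀ {a : Pt} {X : UltraFamily.{w} Pt} (r : El conv a X),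
    ract (comp r (fun x => idArrow (X.obj x))) (run X) = r
  /-- associativity, modulo the associativity isomorphism of `β` -/
  assoc : ∀ {a : Pt} {X : UltraFamily.{w} Pt} (r : El conv a X) {c : X.ι → UltraFamily.{w} Pt}
    (s : ∀ x, El conv (X.obj x) (c x)) (d : ∀ x, (c x).ι → UltraFamily.{w} Pt)
    (t : ∀ x y, El conv ((c x).obj y) (d x y)),
    comp (comp r s) (c := fun p => d p.1 p.2) (fun p => t p.1 p.2) =
      ract (comp r (fun x => comp (s x) (t x)))
        (massoc ⟨X.ι, fun x => ⟨(c x).ι, d x, (c x).uf⟩, X.uf⟩)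

attribute [instance] UltraconvergenceSpace.category UltraconvergenceSpace.discrete

namespace UltraconvergenceSpace

variable (A : UltraconvergenceSpace.{w, u})

variable {A} in
theorem comp_congr {a : A.Pt} {X : UltraFamily.{w} A.Pt} {r r' : El A.conv a X}
    {c : X.ι → UltraFamily.{w} A.Pt} {s s' : ∀ x, El A.conv (X.obj x) (c x)}
    (hr : r = r') (hs : ∀ x, s x = s' x) : A.comp r s = A.comp r' s' := by
  rw [hr, funext hs]

theorem reindex_comp {C : Type u} [Category.{w} C] (X : UltraFamily.{w} C) {J K : Type w} (g : J → X.ι)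
    (ξ : Ultrafilter J) (hg : ξ.map g = X.uf) (k : K → J) (ζ : Ultrafilter K) (hk : ζ.map k = ξ) :
    reindex X g ξ hg ≫ reindex ⟨J, fun j => X.obj (g j), ξ⟩ k ζ hk =
      reindex X (fun i => g (k i)) ζ (by rw [← hg, ← hk, Ultrafilter.map_map]; rfl) := by
  refine homMk_eq (Filter.Eventually.of_forall fun j => ?_)
  exact congrArg (Sigma.mk (g (k j))) (Category.comp_id _)

theorem reindex_id {C : Type u} [Category.{w} C] (X : UltraFamily.{w} C) :
    reindex X id X.uf (Ultrafilter.map_id _) = 𝟙 X := rfl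

variable {A} in
/-- The composite of an ultraconvergence arrow with a representative of an element of the extension
of the profunctor of ultraconvergence arrows. -/
def preStar {a : A.Pt} {X : UltraFamily.{w} A.Pt} {Y : UltraFamily.{w} (UltraFamily.{w} A.Pt)}
    (r : El A.conv a X) (t : PreGerm X.uf Y.uf fun i j => El A.conv (X.obj i) (Y.obj j)) :
    El A.conv a ((mult A.Pt).obj Y) :=
  A.comp (c := Y.obj) (ract r (reindex X (fun j => (t.fam j).1) Y.uf t.push)) fun j => (t.fam j).2

variable {A} in
theorem preStar_eq {a : A.Pt} {X : UltraFamily.{w} A.Pt}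
    {Y : UltraFamily.{w} (UltraFamily.{w} A.Pt)} (r : El A.conv a X)
    (t t' : PreGerm X.uf Y.uf fun i j => El A.conv (X.obj i) (Y.obj j))
    (h : ∀ᶠ j in (Y.uf : Filter Y.ι), t.fam j = t'.fam j) : preStar r t = preStar r t' := by
  let P : Type w := Σ j : Y.ι, Σ i : X.ι, El A.conv (X.obj i) (Y.obj j)
  let φ (t : PreGerm X.uf Y.uf fun i j => El A.conv (X.obj i) (Y.obj j)) (j : Y.ι) : P :=
    ⟨j, t.fam j⟩
  have hφ : Y.uf.map (φ t') = Y.uf.map (φ t) := by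
    apply ultrafilter_ext
    intro p
    change (∀ᶠ j in (Y.uf : Filter Y.ι), p (φ t' j)) ↔ ∀ᶠ j in (Y.uf : Filter Y.ι), p (φ t j)
    refine Filter.eventually_congr (h.mono fun j hj => ?_)
    simp only [φ, hj]
  have hk : (Y.uf.map (φ t)).map (fun p : P => p.2.1) = X.uf := t.push
  let c : P → UltraFamily.{w} A.Pt := fun p => Y.obj p.1
  let W : UltraFamily.{w} (UltraFamily.{w} A.Pt) := ⟨P, c, Y.uf.map (φ t)⟩
  have key : ∀ (t₁ : PreGerm X.uf Y.uf fun i j => El A.conv (X.obj i) (Y.obj j))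
      (h₁ : Y.uf.map (φ t₁) = Y.uf.map (φ t)), preStar r t₁ =
        ract (A.comp (c := c) (ract r (reindex X (fun p : P => p.2.1) (Y.uf.map (φ t)) hk))
          (fun p => p.2.2)) ((mult A.Pt).map (Y := Y) (reindex W (φ t₁) Y.uf h₁)) := by
    intro t₁ h₁
    refine Eq.trans ?_ (A.left_naturality (c := c)
      (ract r (reindex X (fun p : P => p.2.1) (Y.uf.map (φ t)) hk)) (fun p => p.2.2)
      (φ t₁) Y.uf h₁)
    refine comp_congr ?_ fun j => rfl
    rw [← ract_comp, reindex_comp]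
  rw [key t rfl, key t' hφ]
  congr 2
  exact homMk_eq (X := W) (Y := Y) (h.mono fun j hj =>
    congrArg (fun q : Σ i : X.ι, El A.conv (X.obj i) (Y.obj j) =>
      (⟨⟨j, q⟩, 𝟙 (Y.obj j)⟩ : Σ p : P, (W.obj p ⟶ Y.obj j))) hj)

variable {A} in
/-- The composite of an ultraconvergence arrow with an element of the extension of the profunctor
of ultraconvergence arrows. -/
def star {a : A.Pt} {X : UltraFamily.{w} A.Pt} {Y : UltraFamily.{w} (UltraFamily.{w} A.Pt)}
    (r : El A.conv a X) (t : El (betaExt A.conv) X Y) : El A.conv a ((mult A.Pt).obj Y) :=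
  Quotient.lift (preStar r) (preStar_eq r) t

variable {A} in
theorem star_extMk {a : A.Pt} {X : UltraFamily.{w} A.Pt}
    {Y : UltraFamily.{w} (UltraFamily.{w} A.Pt)} (r : El A.conv a X) (g : Y.ι → X.ι)
    (hg : Y.uf.map g = X.uf) (e : ∀ j, El A.conv (X.obj (g j)) (Y.obj j)) :
    star r (extMk g hg e) = A.comp (c := Y.obj) (ract r (reindex X g Y.uf hg)) e := rfl

/-- In a discrete category, every morphism of ultrafamilies is a reindexing. -/
theorem reindex_ind {X : UltraFamily.{w} A.Pt} {m : ∀ Y : UltraFamily.{w} A.Pt, (X ⟶ Y) → Prop}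
    (h : ∀ (J : Type w) (g : J → X.ι) (ξ : Ultrafilter J) (hg : ξ.map g = X.uf),
      m _ (reindex X g ξ hg)) (Y : UltraFamily.{w} A.Pt) (k : X ⟶ Y) : m Y k := by
  induction k using hom_ind with | _ g hg e
  obtain ⟨J, y, ξ⟩ := Y
  change J → X.ι at g
  change ∀ j, X.obj (g j) ⟶ y j at e
  obtain rfl : y = fun j => X.obj (g j) := funext fun j => (IsDiscrete.eq_of_hom (e j)).symm
  obtain rfl : e = fun j => 𝟙 _ := funext fun j => Subsingleton.elim _ _
  exact h J g ξ hg

theorem star_ract {a : A.Pt} {X X' : UltraFamily.{w} A.Pt}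
    {Y : UltraFamily.{w} (UltraFamily.{w} A.Pt)} (r : El A.conv a X) (h : X ⟶ X')
    (t : El (betaExt A.conv) X' Y) : star (ract r h) t = star r (lact h t) := by
  revert t
  refine reindex_ind A (m := fun X' h => ∀ t : El (betaExt A.conv) X' Y,
    star (ract r h) t = star r (lact h t)) (fun J g ξ hg t => ?_) X' h
  induction t using ext_ind with | _ k hk e
  change J → X.ι at g
  change Y.ι → J at k
  refine comp_congr (A := A) (X := ⟨Y.ι, fun j => X.obj (g (k j)), Y.uf⟩) (c := Y.obj) ?_
    fun j => ?_
  · rw [← ract_comp, reindex_comp]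
  · exact (lact_id (e j)).symm

theorem star_mult {a : A.Pt} {X : UltraFamily.{w} A.Pt}
    {Y Y' : UltraFamily.{w} (UltraFamily.{w} A.Pt)} (r : El A.conv a X)
    (t : El (betaExt A.conv) X Y) (k : Y ⟶ Y') :
    star r (ract t k) = ract (star r t) ((mult A.Pt).map k) := by
  induction t using ext_ind with | _ g hg e
  induction k using hom_ind with | _ l hl f
  rw [ract_extMk, star_extMk, star_extMk]
  refine (A.right_naturality (X := ⟨Y'.ι, fun j => X.obj (g (l j)), Y'.uf⟩)
    (c := fun j => Y.obj (l j)) (d := Y'.obj) _ (fun j => e (l j)) f).trans ?_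
  have h1 := A.left_naturality (X := ⟨Y.ι, fun j => X.obj (g j), Y.uf⟩) (c := Y.obj)
    (ract r (reindex X g Y.uf hg)) e l Y'.uf hl
  rw [← ract_comp, reindex_comp] at h1
  rw [h1, ← ract_comp, ← Functor.map_comp]
  congr 2
  exact homMk_eq (Filter.Eventually.of_forall fun j =>
    congrArg (Sigma.mk (l j)) (Category.id_comp (f j)))

/-- The lax algebra, on a discrete category, of an ultraconvergence space. -/
noncomputable def toLaxAlgebra : LaxAlgebra.{w} A.Pt where
  str := A.conv
  small := A.small
  Γ :=
    { app := fun d c h => lact (P := A.conv) (show d ⟶ c from h) (A.idArrow c)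
      app_lact := fun h p => lact_comp (P := A.conv) _ _ _
      app_ract := fun {d c c'} h k => by
        obtain rfl := IsDiscrete.eq_of_hom k
        obtain rfl : k = 𝟙 c := Subsingleton.elim _ _
        refine Eq.trans ?_ (ract_id (P := A.conv) _).symm
        exact congrArg (fun h : d ⟶ c => lact (P := A.conv) h (A.idArrow c))
          (Category.comp_id (show d ⟶ c from h)) }
  Δ := TwoCell.ofPcomp (fun r t => star r t) (fun r h t => star_ract A r h t)
    (fun {a' a X Y} h r t => by
      obtain rfl := IsDiscrete.eq_of_hom h
      obtain rfl : h = 𝟙 a' := Subsingleton.elim _ _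
      rw [lact_id]
      exact (lact_id (P := A.conv) _).symm)
    (fun r t k => star_mult A r t k)
  left_unit a X r := by
    refine Eq.trans ?_ (A.left_unit r)
    congr 1
    change A.comp (ract (lact (𝟙 a) (A.idArrow a)) (𝟙 _)) (fun _ => r) = _
    rw [lact_id, ract_id]
  right_unit a X r := by
    refine Eq.trans ?_ (A.right_unit r)
    congr 1
    refine (comp_congr ?_ fun j => ?_ : A.comp (c := fun x => (unit A.Pt).obj (X.obj x)) _ _ =
      A.comp (c := fun x => (unit A.Pt).obj (X.obj x)) _ _)
    · exact ract_id r
    · exact lact_id _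
  assoc a X Y Z r t T := by
    induction t using ext_ind with | _ g hg e
    induction T using ext_ind₂ with | _ l hl k hk f
    rw [multCell_extMk]
    have h1 := A.assoc (X := ⟨Z.ι, fun j => X.obj (g (l j)), Z.uf⟩)
      (c := fun j => ⟨(Z.obj j).ι, fun b => (Y.obj (l j)).obj (k j b), (Z.obj j).uf⟩)
      (ract r (reindex X (fun j => g (l j)) Z.uf (by rw [← hg, ← hl, Ultrafilter.map_map]; rfl)))
      (fun j => ract (e (l j)) (reindex (Y.obj (l j)) (k j) (Z.obj j).uf (hk j)))
      (fun j b => (Z.obj j).obj b) (fun j b => f j b)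
    refine Eq.trans ?_ h1
    refine comp_congr (A := A) (X := ⟨Σ j, (Z.obj j).ι, fun p => (Y.obj (l p.1)).obj (k p.1 p.2),
      sumU Z.uf fun j => (Z.obj j).uf⟩) (c := fun p => (Z.obj p.1).obj p.2) ?_ fun j => rfl
    have h2 := A.right_naturality (X := ⟨Z.ι, fun j => X.obj (g (l j)), Z.uf⟩)
      (c := fun j => Y.obj (l j))
      (ract r (reindex X (fun j => g (l j)) Z.uf (by rw [← hg, ← hl, Ultrafilter.map_map]; rfl)))
      (fun j => e (l j)) (fun j => reindex (Y.obj (l j)) (k j) (Z.obj j).uf (hk j))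
    have h3 := A.left_naturality (X := ⟨Y.ι, fun j => X.obj (g j), Y.uf⟩) (c := Y.obj)
      (ract r (reindex X g Y.uf hg)) e l Z.uf hl
    rw [← ract_comp, reindex_comp] at h3
    rw [h2, h3, ← ract_comp, ← Functor.map_comp]
    refine congrArg (ract (P := A.conv) (A.comp (c := Y.obj) (ract r (reindex X g Y.uf hg)) e))
      (Eq.trans (b := (mult A.Pt).map (X := Y)
        (Y := ⟨Z.ι, fun j => ⟨(Z.obj j).ι, fun b => (Y.obj (l j)).obj (k j b), (Z.obj j).uf⟩, Z.uf⟩)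
        (homMk l hl fun j => reindex (Y.obj (l j)) (k j) (Z.obj j).uf (hk j))) ?_ ?_)
    · exact (mult_homMk (X := Y)
        (Y := ⟨Z.ι, fun j => ⟨(Z.obj j).ι, fun b => (Y.obj (l j)).obj (k j b), (Z.obj j).uf⟩, Z.uf⟩)
        l hl k hk fun j b => 𝟙 _).symm
    · refine congrArg _ (homMk_eq (Filter.Eventually.of_forall fun j => ?_))
      exact congrArg (Sigma.mk (l j)) (Category.id_comp (reindex (Y.obj (l j)) (k j) _ (hk j))).symm

end UltraconvergenceSpace

/-! ### Continuous maps and transformations -/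

/-- A continuous map of ultraconvergence spaces: a functor with a continuity structure. -/
structure ContinuousMap (A : UltraconvergenceSpace.{w, u₁}) (B : UltraconvergenceSpace.{w, u₂}) where
  functor : A.Pt ⥤ B.Pt
  map : ∀ {a : A.Pt} {X : UltraFamily.{w} A.Pt}, El A.conv a X →
    El B.conv (functor.obj a) ((mapF functor).obj X)
  map_ract : ∀ {a : A.Pt} {X Y : UltraFamily.{w} A.Pt} (r : El A.conv a X) (g : X ⟶ Y),
    map (ract r g) = ract (map r) ((mapF functor).map g)
  map_id : ∀ a : A.Pt, map (A.idArrow a) = B.idArrow (functor.obj a)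
  map_comp : ∀ {a : A.Pt} {X : UltraFamily.{w} A.Pt} (r : El A.conv a X)
    {c : X.ι → UltraFamily.{w} A.Pt} (s : ∀ x, El A.conv (X.obj x) (c x)),
    map (A.comp r s) = B.comp (map r) (fun x => map (s x))

/-- A transformation of continuous maps. The two composites, which are indexed by
`Σ _ : PUnit, X` and by `Σ _ : X, PUnit`, are compared through the unit isomorphisms of `β`. -/
@[ext] structure Transformation {A : UltraconvergenceSpace.{w, u₁}}
    {B : UltraconvergenceSpace.{w, u₂}} (f g : ContinuousMap A B) where
  app : ∀ a : A.Pt, El B.conv (f.functor.obj a) ((unit B.Pt).obj (g.functor.obj a))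
  comm : ∀ {a : A.Pt} {X : UltraFamily.{w} A.Pt} (r : El A.conv a X),
    ract (B.comp (app a) (fun _ => g.map r)) (lun ((mapF g.functor).obj X)) =
      ract (B.comp (f.map r) (fun x => app (X.obj x))) (run ((mapF g.functor).obj X))

/-! ### The category of points of a lax algebra -/

namespace LaxAlgebra

section Star

variable {C : Type u} [Category.{w} C] (A : LaxAlgebra.{w} C)

/-- The value of the multiplication on a pair. -/
def star {a : C} {X : UltraFamily.{w} C} {Y : UltraFamily.{w} (UltraFamily.{w} C)}
    (r : El A.str a X) (t : El (betaExt A.str) X Y) : El A.str a ((mult C).obj Y) :=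
  A.Δ.app a Y (cmk r t)

theorem star_ract {a : C} {X X' : UltraFamily.{w} C} {Y : UltraFamily.{w} (UltraFamily.{w} C)}
    (r : El A.str a X) (h : X ⟶ X') (t : El (betaExt A.str) X' Y) :
    A.star (ract r h) t = A.star r (lact h t) :=
  congrArg (A.Δ.app a Y) (cmk_sound r h t)

theorem star_mult {a : C} {X : UltraFamily.{w} C} {Y Y' : UltraFamily.{w} (UltraFamily.{w} C)}
    (r : El A.str a X) (t : El (betaExt A.str) X Y) (k : Y ⟶ Y') :
    A.star r (ract t k) = ract (A.star r t) ((mult C).map k) :=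
  A.Δ.app_ract (cmk r t) k

theorem star_assoc {a : C} {X : UltraFamily.{w} C} {Y : UltraFamily.{w} (UltraFamily.{w} C)}
    {Z : UltraFamily.{w} (UltraFamily.{w} (UltraFamily.{w} C))}
    (r : El A.str a X) (t : El (betaExt A.str) X Y) (T : El (betaExt (betaExt A.str)) Y Z) :
    A.star (A.star r t) (multCell T) = ract (A.star r (Y := (mapF (mult C)).obj Z)
      (A.Δ.betaExt.app X Z ((laxComp A.str (betaExt A.str)).app X Z (cmk t T)))) (massoc Z) :=
  A.assoc a X Y Z r t T

/-- The composite of `s : a ⇝ (b)` and `r : b ⇝ X`. -/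
noncomputable def act {a b : C} {X : UltraFamily.{w} C} (s : El A.str a ((unit C).obj b))
    (r : El A.str b X) : El A.str a X :=
  ract (A.star (Y := (unit (UltraFamily.{w} C)).obj X) s (unitCell r)) (lun X)

/-- The composite of `r : a ⇝ X` and (the class of) a family of arrows `X (g y) ⇝ (Y y)`. -/
noncomputable def coact {a : C} {X Y : UltraFamily.{w} C} (r : El A.str a X)
    (φ : UGerm X.uf Y.uf fun i j => El A.str (X.obj i) ((unit C).obj (Y.obj j))) : El A.str a Y :=
  ract (A.star (Y := (mapF (unit C)).obj Y) r φ) (run Y)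

/-- The identity arrow of a point. -/
def idPt (a : C) : El A.str a ((unit C).obj a) := A.Γ.app a a (𝟙 a)

theorem idPt_act {a : C} {X : UltraFamily.{w} C} (r : El A.str a X) : A.act (A.idPt a) r = r :=
  A.left_unit a X r

theorem act_idPt {a b : C} (s : El A.str a ((unit C).obj b)) : A.act s (A.idPt b) = s :=
  A.right_unit a _ s

theorem coact_id {a : C} {X : UltraFamily.{w} C} (r : El A.str a X) :
    A.coact r (UGerm.of (E := fun i j => El A.str (X.obj i) ((unit C).obj (X.obj j)))
      id (Ultrafilter.map_id _) fun i => A.idPt (X.obj i)) = r :=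
  A.right_unit a _ r

theorem lun_naturality {X Y : UltraFamily.{w} C} (k : X ⟶ Y) :
    (mult C).map ((unit (UltraFamily.{w} C)).map k) ≫ lun Y = lun X ≫ k := by
  induction k using hom_ind with | _ g hg e
  have h : (mult C).map ((unit (UltraFamily.{w} C)).map (homMk g hg e)) = _ :=
    mult_homMk (X := (unit (UltraFamily.{w} C)).obj X) (Y := (unit (UltraFamily.{w} C)).obj Y)
      id (Ultrafilter.map_id _) (fun _ => g) (fun _ => hg) (fun _ => e)
  rw [h]
  refine homMk_eq (Filter.Eventually.of_forall fun j => ?_)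
  exact congrArg (Sigma.mk _) ((Category.comp_id (e j)).trans (Category.id_comp (e j)).symm)

theorem massoc_lun (Y : UltraFamily.{w} (UltraFamily.{w} C)) :
    massoc ((unit (UltraFamily.{w} (UltraFamily.{w} C))).obj Y) ≫ (mult C).map (lun Y) =
      lun ((mult C).obj Y) := by
  have h : (mult C).map (lun Y) = _ :=
    mult_homMk (X := (mult (UltraFamily.{w} C)).obj ((unit (UltraFamily.{w} (UltraFamily.{w} C))).obj Y))
      (Y := Y) (fun x => (⟨PUnit.unit, x⟩ : Σ _ : PUnit.{w+1}, Y.ι)) rfl (fun _ => id)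
      (fun _ => Ultrafilter.map_id _) (fun _ _ => 𝟙 _)
  rw [h]
  refine homMk_eq (Filter.Eventually.of_forall fun j => ?_)
  exact congrArg (Sigma.mk _) (Category.comp_id _)

theorem massoc_run (Y : UltraFamily.{w} (UltraFamily.{w} C)) :
    massoc ((mapF (unit (UltraFamily.{w} C))).obj Y) ≫ (mult C).map (run Y) =
      (mult C).map (X := (mapF (mult C)).obj ((mapF (unit (UltraFamily.{w} C))).obj Y)) (Y := Y)
        (homMk id (Ultrafilter.map_id _) fun j => lun (Y.obj j)) := by
  have h : (mult C).map (run Y) = _ :=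
    mult_homMk (X := (mult (UltraFamily.{w} C)).obj ((mapF (unit (UltraFamily.{w} C))).obj Y))
      (Y := Y) (fun x => (⟨x, PUnit.unit⟩ : Σ _ : Y.ι, PUnit.{w+1})) rfl (fun _ => id)
      (fun _ => Ultrafilter.map_id _) (fun _ _ => 𝟙 _)
  have h' := mult_homMk (X := (mapF (mult C)).obj ((mapF (unit (UltraFamily.{w} C))).obj Y)) (Y := Y)
    id (Ultrafilter.map_id _)
    (fun j => fun x => (⟨PUnit.unit, x⟩ : Σ _ : PUnit.{w+1}, (Y.obj j).ι)) (fun j => rfl)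
    (fun j x => 𝟙 ((Y.obj j).obj x))
  rw [h]
  refine Eq.trans ?_ h'.symm
  refine homMk_eq (Filter.Eventually.of_forall fun j => ?_)
  exact congrArg (Sigma.mk _) (Category.comp_id _)

theorem massoc_run_run (Y : UltraFamily.{w} (UltraFamily.{w} C)) :
    massoc ((mapF (mapF (unit C))).obj Y) ≫ run ((mult C).obj Y) =
      (mult C).map (X := (mapF (mult C)).obj ((mapF (mapF (unit C))).obj Y)) (Y := Y)
        (homMk id (Ultrafilter.map_id _) fun j => run (Y.obj j)) := by
  have h' := mult_homMk (X := (mapF (mult C)).obj ((mapF (mapF (unit C))).obj Y)) (Y := Y)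
    id (Ultrafilter.map_id _)
    (fun j => fun x => (⟨x, PUnit.unit⟩ : Σ _ : (Y.obj j).ι, PUnit.{w+1})) (fun j => rfl)
    (fun j x => 𝟙 ((Y.obj j).obj x))
  refine Eq.trans ?_ h'.symm
  refine homMk_eq (Filter.Eventually.of_forall fun j => ?_)
  exact congrArg (Sigma.mk _) (Category.comp_id _)

theorem act_ract {a b : C} {X Y : UltraFamily.{w} C} (s : El A.str a ((unit C).obj b))
    (r : El A.str b X) (k : X ⟶ Y) : A.act s (ract r k) = ract (A.act s r) k := by
  have h : unitCell (ract r k) =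
      ract (unitCell r) ((unit (UltraFamily.{w} C)).map k) := rfl
  rw [act, h, star_mult, ← ract_comp, lun_naturality, ract_comp]
  rfl

theorem star_act {a b : C} {X : UltraFamily.{w} C} {Y : UltraFamily.{w} (UltraFamily.{w} C)}
    (s : El A.str a ((unit C).obj b)) (r : El A.str b X) (t : El (betaExt A.str) X Y) :
    A.star (A.act s r) t = A.act s (A.star r t) := by
  have h1 : lact (lun X) t = ract (multCell (F := A.str)
      (Y := (unit (UltraFamily.{w} C)).obj X) (X := (unit (UltraFamily.{w} (UltraFamily.{w} C))).obj Y)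
      (unitCell t)) (lun Y) := by
    induction t using ext_ind with | _ g hg e
    have h := multCell_extMk (F := A.str) (Y := (unit (UltraFamily.{w} C)).obj X)
      (X := (unit (UltraFamily.{w} (UltraFamily.{w} C))).obj Y) id (Ultrafilter.map_id _)
      (fun _ => g) (fun _ => hg) (fun _ => e)
    refine Eq.trans ?_ (congrArg (fun T => ract (P := betaExt A.str) T (lun Y)) h).symm
    refine extMk_congr (F := A.str) (Y := (mult C).obj ((unit (UltraFamily.{w} C)).obj X)) (X := Y)
      (g := fun j => (⟨PUnit.unit, g j⟩ : Σ _ : PUnit.{w+1}, X.ι)) fun j => ?_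
    exact (lact_id (e j)).trans (ract_id (e j)).symm
  rw [act, star_ract, h1, star_mult, star_assoc, ← ract_comp]
  refine congrArg (ract (P := A.str) (A.star (Y := (unit (UltraFamily.{w} C)).obj ((mult C).obj Y))
    s (unitCell (A.star r t)))) (massoc_lun Y)

theorem star_coact {a : C} {X X' : UltraFamily.{w} C} {Y : UltraFamily.{w} (UltraFamily.{w} C)}
    (r : El A.str a X)
    (φ : UGerm X.uf X'.uf fun i j => El A.str (X.obj i) ((unit C).obj (X'.obj j)))
    (t : El (betaExt A.str) X' Y) :
    A.star (A.coact r φ) t = A.star r (Y := Y)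
      (UGerm.comp (E := fun i j => El A.str (X.obj i) ((unit C).obj (X'.obj j)))
        (E' := fun i j => El A.str (X'.obj i) (Y.obj j)) (F := fun i j => El A.str (X.obj i) (Y.obj j))
        (fun _ _ _ s r => A.act s r) φ t) := by
  induction t using ext_ind with | _ g hg e
  induction φ using UGerm.ind with | _ k hk f
  let T : El (betaExt (betaExt A.str)) ((mapF (unit C)).obj X')
      ((mapF (unit (UltraFamily.{w} C))).obj Y) :=
    extMk (F := betaExt A.str) (Y := (mapF (unit C)).obj X')
      (X := (mapF (unit (UltraFamily.{w} C))).obj Y) g hg fun j => unitCell (e j)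
  have h1 : lact (run X') (extMk g hg e) = ract (multCell T) (run Y) := by
    have h := multCell_extMk (F := A.str) (Y := (mapF (unit C)).obj X')
      (X := (mapF (unit (UltraFamily.{w} C))).obj Y) g hg (fun _ => id)
      (fun _ => Ultrafilter.map_id _) (fun j _ => e j)
    refine Eq.trans ?_ (congrArg (fun T => ract (P := betaExt A.str) T (run Y)) h).symm
    refine extMk_congr (F := A.str) (Y := (mult C).obj ((mapF (unit C)).obj X')) (X := Y)
      (g := fun j => (⟨g j, PUnit.unit⟩ : Σ _ : X'.ι, PUnit.{w+1})) fun j => ?_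
    exact (lact_id (e j)).trans (ract_id (e j)).symm
  have h2 := A.star_assoc r
    (extMk (F := A.str) (Y := X) (X := (mapF (unit C)).obj X') k hk f) T
  rw [coact, star_ract, h1, star_mult]
  refine (congrArg (fun x => ract (P := A.str) x ((mult C).map (run Y))) h2).trans ?_
  rw [← ract_comp, massoc_run]
  exact (A.star_mult (Y := (mapF (mult C)).obj ((mapF (unit (UltraFamily.{w} C))).obj Y)) (Y' := Y) r
    _ (homMk id (Ultrafilter.map_id _) fun j => lun (Y.obj j))).symm

theorem coact_star {a : C} {X : UltraFamily.{w} C} {Y Y' : UltraFamily.{w} (UltraFamily.{w} C)}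
    (r : El A.str a X) (t : El (betaExt A.str) X Y)
    (k : El (betaExt (betaExt A.str)) Y ((mapF (mapF (unit C))).obj Y')) :
    A.star r (Y := Y')
      (UGerm.comp (E := fun i j => El A.str (X.obj i) (Y.obj j))
        (E' := fun i j => UGerm (Y.obj i).uf (Y'.obj j).uf fun a b =>
          El A.str ((Y.obj i).obj a) ((unit C).obj ((Y'.obj j).obj b)))
        (F := fun i j => El A.str (X.obj i) (Y'.obj j))
        (fun _ _ _ r φ => A.coact r φ) t k) =
      A.coact (Y := (mult C).obj Y') (A.star r t) (multCell k) := by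
  induction t using ext_ind with | _ g hg e
  induction k using ext_ind with | _ l hl κ
  have h2 := A.star_assoc r (extMk g hg e) (extMk (F := betaExt A.str)
    (Y := Y) (X := (mapF (mapF (unit C))).obj Y') l hl κ)
  refine Eq.trans ?_ (congrArg (fun x => ract (P := A.str) x (run ((mult C).obj Y'))) h2).symm
  refine Eq.trans ?_ (ract_comp (P := A.str) _ _ _)
  refine Eq.trans ?_ (congrArg (ract (P := A.str) _) (massoc_run_run Y').symm)
  exact A.star_mult (Y := (mapF (mult C)).obj ((mapF (mapF (unit C))).obj Y')) (Y' := Y') r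
    (A.Δ.betaExt.app X ((mapF (mapF (unit C))).obj Y')
      ((laxComp A.str (betaExt A.str)).app X ((mapF (mapF (unit C))).obj Y')
        (cmk (extMk (F := A.str) g hg e)
          (extMk (F := betaExt A.str) (Y := Y) (X := (mapF (mapF (unit C))).obj Y') l hl κ))))
    (homMk id (Ultrafilter.map_id _) fun j => run (Y'.obj j))

/-- The composite of `s : a ⇝ (b)` and `r : b ⇝ X` as a value of the covariant action. -/
theorem coact_unit {a b c : C} (s : El A.str a ((unit C).obj b))
    (r : El A.str b ((unit C).obj c)) :
    A.coact (Y := (unit C).obj c) s (unitCell r) = A.act s r := rfl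

theorem act_act {a b c : C} {X : UltraFamily.{w} C} (s : El A.str a ((unit C).obj b))
    (r : El A.str b ((unit C).obj c)) (q : El A.str c X) :
    A.act (A.act s r) q = A.act s (A.act r q) := by
  conv_lhs => rw [act, star_act]
  conv_rhs => rw [act.eq_1 A r q, act_ract]

theorem act_coact {a b : C} {X Y : UltraFamily.{w} C} (s : El A.str a ((unit C).obj b))
    (r : El A.str b X)
    (φ : UGerm X.uf Y.uf fun i j => El A.str (X.obj i) ((unit C).obj (Y.obj j))) :
    A.act s (A.coact r φ) = A.coact (A.act s r) φ := by
  rw [coact, act_ract]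
  exact congrArg (fun x => ract (P := A.str) x (run Y))
    (A.star_act s r (show El (betaExt A.str) X ((mapF (unit C)).obj Y) from φ)).symm

theorem coact_coact {a : C} {X Y Z : UltraFamily.{w} C} (r : El A.str a X)
    (φ : UGerm X.uf Y.uf fun i j => El A.str (X.obj i) ((unit C).obj (Y.obj j)))
    (ψ : UGerm Y.uf Z.uf fun i j => El A.str (Y.obj i) ((unit C).obj (Z.obj j))) :
    A.coact (A.coact r φ) ψ = A.coact r
      (UGerm.comp (E := fun i j => El A.str (X.obj i) ((unit C).obj (Y.obj j)))
        (E' := fun i j => El A.str (Y.obj i) ((unit C).obj (Z.obj j)))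
        (F := fun i j => El A.str (X.obj i) ((unit C).obj (Z.obj j)))
        (fun _ _ _ s r => A.act s r) φ ψ) :=
  congrArg (fun x => ract (P := A.str) x (run Z))
    (A.star_coact r φ (show El (betaExt A.str) Y ((mapF (unit C)).obj Z) from ψ))

/-- The action of `Γ` on morphisms. -/
theorem coact_Γ {a : C} {X Y : UltraFamily.{w} C} (r : El A.str a X) (k : X ⟶ Y) :
    A.coact r (UGerm.map (E := fun i j => (X.obj i ⟶ Y.obj j))
      (E₁ := fun i j => El A.str (X.obj i) ((unit C).obj (Y.obj j)))
      (fun i j h => A.Γ.app (X.obj i) (Y.obj j) h) k) = ract r k := by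
  have h := A.right_unit a Y (ract r k)
  refine Eq.trans ?_ h
  refine congrArg (fun x => ract (P := A.str) x (run Y)) ?_
  refine Eq.trans ?_ (A.star_ract r k (Y := (mapF (unit C)).obj Y) (A.Γ.betaExt.app Y Y (𝟙 Y))).symm
  refine congrArg (A.star r) ?_
  have h' := A.Γ.betaExt.app_lact k (𝟙 Y)
  refine Eq.trans ?_ h'
  exact congrArg (A.Γ.betaExt.app X Y) (Category.comp_id k).symm

end Star

end LaxAlgebra

namespace LaxAlgebra

variable {C : Type u} [Category.{w} C] (A : LaxAlgebra.{w} C)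

/-- The objects of the category of points of a lax algebra: those of its carrier. -/
def Pts (_ : LaxAlgebra.{w} C) : Type u := C

/-- The category of points of a lax algebra: morphisms `a ⟶ b` are the elements `a ⇝ (b)` of the
structure profunctor. -/
noncomputable instance Pts.category : Category.{w} A.Pts where
  Hom a b := El A.str a ((unit C).obj b)
  id a := A.idPt a
  comp s r := A.act s r
  id_comp r := A.idPt_act r
  comp_id s := A.act_idPt s
  assoc s r q := A.act_act s r q

theorem lact_act {a' a b : C} {X : UltraFamily.{w} C} (h : a' ⟶ a)
    (s : El A.str a ((unit C).obj b)) (r : El A.str b X) :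
    A.act (lact h s) r = lact h (A.act s r) := by
  rw [act, act, lact_ract]
  exact congrArg (fun x => ract (P := A.str) x (lun X))
    (A.Δ.app_lact h (cmk s (unitCell r)))

/-- The comparison functor from the carrier of a lax algebra to its category of points. -/
noncomputable def comparison : C ⥤ A.Pts where
  obj a := a
  map {a b} h := A.Γ.app a b h
  map_id a := rfl
  map_comp {a b c} h k := by
    have h1 : ∀ {a b c : C} (h : a ⟶ b) (k : b ⟶ c),
        A.Γ.app a c (h ≫ k) = lact (P := A.str) h (A.Γ.app b c k) := fun h k => A.Γ.app_lact h k
    have h2 : A.Γ.app a b h = lact (P := A.str) h (A.idPt b) :=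
      (congrArg (A.Γ.app a b) (Category.comp_id h).symm).trans (h1 h (𝟙 b))
    refine (h1 h k).trans (Eq.symm ?_)
    change A.act (A.Γ.app a b h) (A.Γ.app b c k) = _
    rw [h2]
    exact (A.lact_act h (A.idPt b) (A.Γ.app b c k)).trans
      (congrArg (lact (P := A.str) h) (A.idPt_act _))

/-- A lax algebra is normalized if its comparison functor is fully faithful. -/
def IsNormalized : Prop := A.comparison.Full ∧ A.comparison.Faithful

/-- The profunctor from `β (Pts A)` to `Pts A` with the same elements as `A`. -/
noncomputable def ptStr : Profunctor.{w} (UltraFamily.{w} A.Pts) A.Pts :=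
  mkProf (fun a X => El A.str a ⟨X.ι, X.obj, X.uf⟩)
    (fun {_ _ X} s r => A.act (X := ⟨X.ι, X.obj, X.uf⟩) s r)
    (fun {_ X Y} r φ => A.coact (X := ⟨X.ι, X.obj, X.uf⟩) (Y := ⟨Y.ι, Y.obj, Y.uf⟩) r φ)
    (fun r => A.idPt_act r) (fun s s' r => A.act_act s s' r) (fun r => A.coact_id r)
    (fun r φ ψ => (A.coact_coact r φ ψ).symm) (fun s r φ => A.act_coact s r φ)

/-- The structure of a lax algebra on the category of points. -/
noncomputable def pt (small : IsSmall A.ptStr) : LaxAlgebra.{w} A.Pts where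
  str := A.ptStr
  small := small
  Γ :=
    { app := fun a b s => s
      app_lact := fun h p => rfl
      app_ract := fun p k => rfl }
  Δ := TwoCell.ofPcomp
    (fun {a X Y} r t => A.star (X := ⟨X.ι, X.obj, X.uf⟩)
      (Y := ⟨Y.ι, fun j => ⟨(Y.obj j).ι, (Y.obj j).obj, (Y.obj j).uf⟩, Y.uf⟩) r t)
    (fun {a X X' Y} r φ t => A.star_coact (X := ⟨X.ι, X.obj, X.uf⟩) (X' := ⟨X'.ι, X'.obj, X'.uf⟩)
      (Y := ⟨Y.ι, fun j => ⟨(Y.obj j).ι, (Y.obj j).obj, (Y.obj j).uf⟩, Y.uf⟩) r φ t)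
    (fun {_ _ X Y} s r t => A.star_act (X := ⟨X.ι, X.obj, X.uf⟩)
      (Y := ⟨Y.ι, fun j => ⟨(Y.obj j).ι, (Y.obj j).obj, (Y.obj j).uf⟩, Y.uf⟩) s r t)
    (fun {a X Y Y'} r t k => A.coact_star (X := ⟨X.ι, X.obj, X.uf⟩)
      (Y := ⟨Y.ι, fun j => ⟨(Y.obj j).ι, (Y.obj j).obj, (Y.obj j).uf⟩, Y.uf⟩)
      (Y' := ⟨Y'.ι, fun j => ⟨(Y'.obj j).ι, (Y'.obj j).obj, (Y'.obj j).uf⟩, Y'.uf⟩) r t k)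
  left_unit a X r :=
    (A.coact_Γ _ (lun (C := C) ⟨X.ι, X.obj, X.uf⟩)).trans
      (A.left_unit a ⟨X.ι, X.obj, X.uf⟩ r)
  right_unit a X r :=
    (A.coact_Γ _ (run (C := C) ⟨X.ι, X.obj, X.uf⟩)).trans
      (A.right_unit a ⟨X.ι, X.obj, X.uf⟩ r)
  assoc a X Y Z r t T := by
    let Z' : UltraFamily.{w} (UltraFamily.{w} (UltraFamily.{w} C)) :=
      ⟨Z.ι, fun j => ⟨(Z.obj j).ι, fun b => ⟨((Z.obj j).obj b).ι, ((Z.obj j).obj b).obj,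
        ((Z.obj j).obj b).uf⟩, (Z.obj j).uf⟩, Z.uf⟩
    induction t using ext_ind with | _ g hg e
    induction T using ext_ind with | _ l hl κ
    exact (A.assoc a ⟨X.ι, X.obj, X.uf⟩
      ⟨Y.ι, fun j => ⟨(Y.obj j).ι, (Y.obj j).obj, (Y.obj j).uf⟩, Y.uf⟩ Z' r
      (UGerm.of g hg e) (UGerm.of l hl κ)).trans (A.coact_Γ _ (massoc Z')).symm

/-- The comparison functor of `pt A` is the identity, so `pt A` is normalized. -/
theorem isNormalized_pt (small : IsSmall A.ptStr) : (A.pt small).IsNormalized :=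
  ⟨⟨fun s => ⟨s, rfl⟩⟩, ⟨fun h => h⟩⟩

end LaxAlgebra

/-- A normalized lax algebra: the comparison functor to its category of points is fully
faithful. -/
structure NormalizedLaxAlgebra (C : Type u) [Category.{w} C] extends LaxAlgebra.{w} C where
  normalized : toLaxAlgebra.IsNormalized

section Small

variable {C : Type u₁} [Category.{w} C] {D : Type u₂} [Category.{w} D]

theorem isSmall_of_small (P : Profunctor.{w} C D) (h : ∀ c, Small.{w} (Σ d, El P d c)) :
    IsSmall P := by
  intro c
  have : Small.{w} (CostructuredArrow yoneda (P.obj c)) := by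
    have := h c
    refine small_of_surjective (α := Σ d, El P d c)
      (f := fun x => CostructuredArrow.mk (yonedaEquiv.symm
        (show (P.obj c).obj (op x.1) from x.2))) fun f => ?_
    obtain ⟨x, hx⟩ := (yonedaEquiv (X := f.left) (F := P.obj c)).symm.surjective f.hom
    refine ⟨⟨f.left, x⟩, ?_⟩
    change CostructuredArrow.mk (yonedaEquiv.symm x) = f
    rw [hx]
    exact (CostructuredArrow.eq_mk f).symm
  have : EssentiallySmall.{w} (CostructuredArrow yoneda (P.obj c)) :=
    essentiallySmall_of_small_of_locallySmall _
  let e := (equivSmallModel.{w} (CostructuredArrow yoneda (P.obj c))).symm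
  exact ⟨SmallModel.{w} (CostructuredArrow yoneda (P.obj c)), inferInstance,
    e.functor ⋙ CostructuredArrow.proj yoneda (P.obj c),
    (Presheaf.tautologicalCocone (P.obj c)).whisker e.functor,
    ⟨(Presheaf.isColimitTautologicalCocone (P.obj c)).whiskerEquivalence e⟩, ⟨Iso.refl _⟩⟩

theorem small_of_isSmall [IsDiscrete D] (P : Profunctor.{w} C D) (h : IsSmall P) (c : C) :
    Small.{w} (Σ d, El P d c) := by
  obtain ⟨J, _, K, s, ⟨hs⟩, ⟨i⟩⟩ := h c
  refine small_of_surjective (α := J)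
    (f := fun j => ⟨K.obj j, i.hom.app (op (K.obj j)) ((s.ι.app j).app (op (K.obj j)) (𝟙 (K.obj j)))⟩)
    ?_
  rintro ⟨d, p⟩
  obtain ⟨j, f, hf⟩ := Limits.Types.jointly_surjective _
    (Limits.isColimitOfPreserves ((evaluation Dᵒᵖ (Type w)).obj (op d)) hs) (i.inv.app (op d) p)
  have f' : d ⟶ K.obj j := f
  refine ⟨j, ?_⟩
  obtain rfl : d = K.obj j := IsDiscrete.eq_of_hom f'
  obtain rfl : f = 𝟙 (K.obj j) := Subsingleton.elim (α := (K.obj j ⟶ K.obj j)) _ _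
  refine congrArg (Sigma.mk (K.obj j)) ?_
  have h2 : i.hom.app (op (K.obj j)) (i.inv.app (op (K.obj j)) p) = p :=
    congrArg (fun m : P.obj c ⟶ P.obj c => m.app (op (K.obj j)) p) i.inv_hom_id
  exact (congrArg (fun x => i.hom.app (op (K.obj j)) x) hf).trans h2

end Small

namespace UltraconvergenceSpace

variable (A : UltraconvergenceSpace.{w, u})

theorem isSmall_ptStr : IsSmall A.toLaxAlgebra.ptStr :=
  isSmall_of_small _ fun X => small_of_isSmall A.conv A.small ⟨X.ι, X.obj, X.uf⟩

/-- An ultraconvergence space as a normalized lax algebra: the lax algebra on the category of points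
of the corresponding lax algebra on a discrete category. -/
noncomputable def toNormalized : NormalizedLaxAlgebra.{w} A.toLaxAlgebra.Pts where
  toLaxAlgebra := A.toLaxAlgebra.pt A.isSmall_ptStr
  normalized := A.toLaxAlgebra.isNormalized_pt A.isSmall_ptStr

end UltraconvergenceSpace

namespace ContinuousMap

variable {A : UltraconvergenceSpace.{w, u₁}} {B : UltraconvergenceSpace.{w, u₂}}
  (f : ContinuousMap A B)

theorem map_star {a : A.Pt} {X : UltraFamily.{w} A.Pt} {Y : UltraFamily.{w} (UltraFamily.{w} A.Pt)}
    (r : El A.conv a X) (t : El (betaExt A.conv) X Y) :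
    f.map (UltraconvergenceSpace.star r t) =
      UltraconvergenceSpace.star (X := (mapF f.functor).obj X) (Y := (mapF (mapF f.functor)).obj Y)
        (f.map r) (UGerm.map (E := fun i j => El A.conv (X.obj i) (Y.obj j))
          (E₁ := fun i j => El B.conv (f.functor.obj (X.obj i)) ((mapF f.functor).obj (Y.obj j)))
          (fun _ _ s => f.map s) t) := by
  induction t using ext_ind with | _ g hg e
  refine (f.map_comp (X := ⟨Y.ι, fun j => X.obj (g j), Y.uf⟩) (c := Y.obj) _ e).trans ?_
  refine UltraconvergenceSpace.comp_congr (A := B)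
    (X := ⟨Y.ι, fun j => f.functor.obj (X.obj (g j)), Y.uf⟩)
    (c := fun j => (mapF f.functor).obj (Y.obj j)) ?_ fun j => rfl
  refine (f.map_ract r _).trans ?_
  refine congrArg (ract (P := B.conv) (f.map r)) ?_
  exact homMk_eq (X := (mapF f.functor).obj X)
    (Y := ⟨Y.ι, fun j => f.functor.obj (X.obj (g j)), Y.uf⟩)
    (Filter.Eventually.of_forall fun j => congrArg (Sigma.mk (g j)) (f.functor.map_id _))

theorem mapF_lun {C : Type u₁} [Category.{w} C] {D : Type u₂} [Category.{w} D] (F : C ⥤ D)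
    (X : UltraFamily.{w} C) : (mapF F).map (lun X) = lun ((mapF F).obj X) :=
  homMk_eq (X := (mult D).obj ((unit (UltraFamily.{w} D)).obj ((mapF F).obj X)))
    (Y := (mapF F).obj X)
    (Filter.Eventually.of_forall fun _ => congrArg (Sigma.mk _) (F.map_id _))

theorem mapF_run {C : Type u₁} [Category.{w} C] {D : Type u₂} [Category.{w} D] (F : C ⥤ D)
    (X : UltraFamily.{w} C) : (mapF F).map (run X) = run ((mapF F).obj X) :=
  homMk_eq (X := (mult D).obj ((mapF (unit D)).obj ((mapF F).obj X)))
    (Y := (mapF F).obj X)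
    (Filter.Eventually.of_forall fun _ => congrArg (Sigma.mk _) (F.map_id _))

theorem map_act {a b : A.Pt} {X : UltraFamily.{w} A.Pt} (s : El A.conv a ((unit A.Pt).obj b))
    (r : El A.conv b X) :
    f.map (A.toLaxAlgebra.act s r) = B.toLaxAlgebra.act (b := f.functor.obj b)
      (X := (mapF f.functor).obj X) (f.map s) (f.map r) := by
  refine (f.map_ract _ (lun X)).trans ?_
  rw [mapF_lun]
  exact congrArg (fun x => ract (P := B.conv) x (lun ((mapF f.functor).obj X)))
    (f.map_star (Y := (unit (UltraFamily.{w} A.Pt)).obj X) s (unitCell r))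

theorem map_coact {a : A.Pt} {X Y : UltraFamily.{w} A.Pt} (r : El A.conv a X)
    (φ : UGerm X.uf Y.uf fun i j => El A.conv (X.obj i) ((unit A.Pt).obj (Y.obj j))) :
    f.map (A.toLaxAlgebra.coact r φ) = B.toLaxAlgebra.coact (X := (mapF f.functor).obj X)
      (Y := (mapF f.functor).obj Y) (f.map r)
      (UGerm.map (E := fun i j => El A.conv (X.obj i) ((unit A.Pt).obj (Y.obj j)))
        (E₁ := fun i j => El B.conv (f.functor.obj (X.obj i))
          ((unit B.Pt).obj (f.functor.obj (Y.obj j)))) (fun _ _ s => f.map s) φ) := by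
  refine (f.map_ract _ (run Y)).trans ?_
  rw [mapF_run]
  exact congrArg (fun x => ract (P := B.conv) x (run ((mapF f.functor).obj Y)))
    (f.map_star (Y := (mapF (unit A.Pt)).obj Y) r φ)

theorem map_idPt (a : A.Pt) :
    f.map (A.toLaxAlgebra.idPt a) = B.toLaxAlgebra.idPt (f.functor.obj a) := by
  have hA : A.toLaxAlgebra.idPt a = A.idArrow a := lact_id (P := A.conv) _
  have hB : B.toLaxAlgebra.idPt (f.functor.obj a) = B.idArrow (f.functor.obj a) :=
    lact_id (P := B.conv) _
  rw [hB, ← f.map_id]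
  exact congrArg f.map hA

/-- The functor between categories of points induced by a continuous map. -/
noncomputable def ptFunctor : A.toLaxAlgebra.Pts ⥤ B.toLaxAlgebra.Pts where
  obj a := f.functor.obj a
  map s := f.map s
  map_id a := f.map_idPt a
  map_comp s r := f.map_act s r

/-- A continuous map as a representable colax morphism of normalized lax algebras. -/
noncomputable def toColax :
    ColaxMorphism A.toNormalized.toLaxAlgebra B.toNormalized.toLaxAlgebra where
  functor := f.ptFunctor
  Θ := TwoCell.ofPcomp
    (fun {d c X} h r => B.toLaxAlgebra.act (b := f.functor.obj c)
      (X := ⟨X.ι, fun i => f.functor.obj (X.obj i), X.uf⟩) h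
      (f.map (X := ⟨X.ι, X.obj, X.uf⟩) r))
    (fun {d c c' X} h k r => by
      refine (B.toLaxAlgebra.act_act (b := f.functor.obj c) (c := f.functor.obj c')
        (X := ⟨X.ι, fun i => f.functor.obj (X.obj i), X.uf⟩) h (f.map k) (f.map r)).trans ?_
      exact congrArg (B.toLaxAlgebra.act (b := f.functor.obj c) h)
        (f.map_act (X := ⟨X.ι, X.obj, X.uf⟩) k r).symm)
    (fun {d' d c X} s h r => B.toLaxAlgebra.act_act (c := f.functor.obj c)
      (X := ⟨X.ι, fun i => f.functor.obj (X.obj i), X.uf⟩) s h (f.map r))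
    (fun {d c X X'} h r φ => by
      refine Eq.trans ?_ (B.toLaxAlgebra.act_coact (b := f.functor.obj c)
        (X := ⟨X.ι, fun i => f.functor.obj (X.obj i), X.uf⟩)
        (Y := ⟨X'.ι, fun i => f.functor.obj (X'.obj i), X'.uf⟩) h (f.map r) _)
      exact congrArg (B.toLaxAlgebra.act (b := f.functor.obj c) h)
        (f.map_coact (X := ⟨X.ι, X.obj, X.uf⟩) (Y := ⟨X'.ι, X'.obj, X'.uf⟩) r φ))
  unit_comp d c h := by
    refine Eq.trans ?_ (B.toLaxAlgebra.act_idPt h)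
    exact congrArg (B.toLaxAlgebra.act (b := f.functor.obj c) h) (f.map_idPt c)
  mult_comp d c X Y h r t := by
    induction t using ext_ind with | _ g hg e
    refine (congrArg (B.toLaxAlgebra.act (b := f.functor.obj c) h) (f.map_star
      (X := ⟨X.ι, X.obj, X.uf⟩)
      (Y := ⟨Y.ι, fun j => ⟨(Y.obj j).ι, (Y.obj j).obj, (Y.obj j).uf⟩, Y.uf⟩) r
      (extMk g hg e))).trans ?_
    refine (B.toLaxAlgebra.star_act (b := f.functor.obj c)
      (X := ⟨X.ι, fun i => f.functor.obj (X.obj i), X.uf⟩)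
      (Y := ⟨Y.ι, fun j => ⟨(Y.obj j).ι, fun b => f.functor.obj ((Y.obj j).obj b), (Y.obj j).uf⟩,
        Y.uf⟩) h (f.map r) (UGerm.of g hg fun j => f.map (e j))).symm.trans ?_
    have key : ∀ j, f.map (e j) = B.toLaxAlgebra.act (b := f.functor.obj (X.obj (g j)))
        (B.toLaxAlgebra.idPt (f.functor.obj (X.obj (g j)))) (f.map (e j)) :=
      fun j => (B.toLaxAlgebra.idPt_act (f.map (e j))).symm
    exact congrArg (fun e' : ∀ j, El B.conv (f.functor.obj (X.obj (g j)))
        ⟨(Y.obj j).ι, fun b => f.functor.obj ((Y.obj j).obj b), (Y.obj j).uf⟩ =>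
      B.toLaxAlgebra.star (X := ⟨X.ι, fun i => f.functor.obj (X.obj i), X.uf⟩)
      (Y := ⟨Y.ι, fun j => ⟨(Y.obj j).ι, fun b => f.functor.obj ((Y.obj j).obj b), (Y.obj j).uf⟩,
        Y.uf⟩) (B.toLaxAlgebra.act (b := f.functor.obj c) h (f.map r)) (UGerm.of g hg e'))
      (funext key)

end ContinuousMap

end UltraConv

/-! The bijection is the Yoneda lemma, followed by a comparison of two equations.

Since `f_⋄(d, c) = Hom(d, f c)`, a `2`-cell `σ : f_⋄ ⇒ g_⋄` commutes with restriction along `h : d ⟶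
f c`, so it is postcomposition with its value at the identity of `f c` (`TwoCell.app_eq_comp`).
These values form a natural transformation between the functors, and conversely every natural
transformation gives a `2`-cell (`TwoCell.ofNatTrans`). For the functors between categories of
points, a morphism `f a ⟶ g a` is by definition an arrow `f a ⇝ (g a)`, so the components at
identities are exactly the data `α_a` of a transformation. What remains is to match the
transformation law with the naturality of `α` and the algebra equation.

Naturality is the special case of the transformation law in which the target of `r` is a one-point
family `(b)`: there the law reads as a commuting square in the category of points.

The algebra equation lives in the composite `B ∘ β(g_⋄)`, a coend. By the co-Yoneda lemma this
composite is the restriction of `B` along `β g`, and the comparison `reprCell` is injective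
(`reprCell_injective`), so it can be cancelled. Evaluated at the class of a pair `(h, r)`, with `h :
d ⟶ f c` and `r : c ⇝ (b_x)`, the equation then says that `Θ_f(h, r)` followed by the family
`(σ(id_{f b_x}))_x` equals `Θ_g(σ h, r)` (`algebraTwoCell_comm_iff`). With `Θ_f(h, r) = f(r) · h`
and `σ h = α_c · h`, this is `(α_{b_x})_x · (f(r) · h) = g(r) · (α_c · h)`.

By associativity both sides are the composites with `h` of the two sides of the transformation law
(`transformation_comm_iff`). Thus the law implies the equation for every `h`, and the equation at `h
= id` gives back the law. Both round trips, and the description of the bijection on identities, come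
down to the unit laws in the category of points and the Yoneda formula. -/

namespace UltraConv

open UltraFamily

/-! ### Co-Yoneda: composing with `β(f_⋄)` is restriction along `β f`. -/

section ReprCell

variable {C : Type u₁} [Category.{w} C] {D : Type u₂} [Category.{w} D]

/-- The inverse of `reprCell`: a pair `(q, t)` is sent to the image of `q` under `t`, seen as a
morphism of ultrafamilies. -/
def reprCellInv (Q : Profunctor.{w} (UltraFamily.{w} D) D) (f : C ⥤ D) :
    TwoCell (pcomp Q (betaExt f.toProfunctor)) (mapF f ⋙ Q) :=
  TwoCell.ofPcomp
    -- An element of `β(f_⋄)(Y, X)` is a germ of a family of morphisms `Y_{g x} ⟶ f(X_x)`, which is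
    -- literally a morphism `Y ⟶ (β f) X`; the contravariant action is composition of such
    -- morphisms, so the pairing is balanced by functoriality of `Q`.
    (fun {_ Y X} q t => ract (P := Q) q (show Y ⟶ (mapF f).obj X from t))
    (fun {_ _ Y' X} q h t =>
      (ract_comp (P := Q) q h (show Y' ⟶ (mapF f).obj X from t)).symm)
    (fun {_ _ Y X} h q t => (lact_ract (P := Q) h q (show Y ⟶ (mapF f).obj X from t)).symm)
    (fun {_ Y X X'} q t k => by
      -- The goal left is that the covariant action of `k` on `t` is composition with `(β f)(k)`; on
      -- representatives both are the same family of composites.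
      refine Eq.trans (congrArg (ract (P := Q) q) ?_)
        (ract_comp (P := Q) q (show Y ⟶ (mapF f).obj X from t) ((mapF f).map k))
      induction t using ext_ind with | _ g hg e
      induction k using hom_ind with | _ l hl e'
      rfl)

theorem reprCellInv_reprCell (Q : Profunctor.{w} (UltraFamily.{w} D) D) (f : C ⥤ D) {d : D}
    {X : UltraFamily.{w} C} (q : El (mapF f ⋙ Q) d X) :
    (reprCellInv Q f).app d X ((reprCell Q f).app d X q) = q :=
  ract_id (P := Q) (c := (mapF f).obj X) q

/-- A left inverse is all that is needed. It lets `reprCell` be cancelled from an equation between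
classes in the coend `Q ∘ β(f_⋄)`, leaving an equation between genuine elements of `Q`. -/
theorem reprCell_injective (Q : Profunctor.{w} (UltraFamily.{w} D) D) (f : C ⥤ D) (d : D)
    (X : UltraFamily.{w} C) : Function.Injective ((reprCell Q f).app d X) :=
  Function.LeftInverse.injective (reprCellInv_reprCell Q f)

/-- The normal form of a class in the coend: write `t` as the restriction of an identity along `t`,
then slide `t` across the coend relation so that it acts on `q` and leaves the identity in the
second slot. -/
theorem cmk_eq_reprCell (Q : Profunctor.{w} (UltraFamily.{w} D) D) (f : C ⥤ D) {d : D}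
    {Y : UltraFamily.{w} D} {X : UltraFamily.{w} C} (q : El Q d Y) (t : Y ⟶ (mapF f).obj X) :
    cmk (G := Q) (F := betaExt f.toProfunctor) (c := X) q t =
      (reprCell Q f).app d X (ract (P := Q) q t) :=
  (congrArg (cmk (G := Q) (F := betaExt f.toProfunctor) (c := X) q)
    (Category.comp_id t).symm).trans
      (cmk_sound (G := Q) (F := betaExt f.toProfunctor) (c := X) q t
        (show El (betaExt f.toProfunctor) ((mapF f).obj X) X from 𝟙 ((mapF f).obj X))).symm

end ReprCell

/-! ### The algebra equation on elements. -/

section AlgebraTwoCell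

variable {C : Type u₁} [Category.{w} C] {D : Type u₂} [Category.{w} D] {A : LaxAlgebra.{w} C}
  {B : LaxAlgebra.{w} D} {F G : ColaxMorphism A B}

/-- The morphism of ultrafamilies whose components are the values of a `2`-cell `f_⋄ ⇒ g_⋄` at
identities. -/
def TwoCell.familyHom {f g : C ⥤ D} (σ : TwoCell f.toProfunctor g.toProfunctor)
    (X : UltraFamily.{w} C) : (mapF f).obj X ⟶ (mapF g).obj X :=
  homMk (X := (mapF f).obj X) (Y := (mapF g).obj X) id (Ultrafilter.map_id _)
    fun x => σ.app (f.obj (X.obj x)) (X.obj x) (𝟙 (f.obj (X.obj x)))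

theorem AlgebraTwoCell.ext_cell {σ τ : AlgebraTwoCell F G} (h : σ.cell = τ.cell) : σ = τ := by
  cases σ
  cases τ
  cases h
  rfl

/-- Compatibility of a `2`-cell with the structure `2`-cells, on elements. -/
theorem algebraTwoCell_comm_iff (σ : TwoCell F.functor.toProfunctor G.functor.toProfunctor) :
    (TwoCell.whiskerLeft B.str σ.betaExt).vcomp ((reprCell B.str F.functor).vcomp F.Θ) =
        (reprCell B.str G.functor).vcomp (G.Θ.vcomp (σ.whiskerRight A.str)) ↔
      ∀ (d : D) (c : C) (X : UltraFamily.{w} C) (h : El F.functor.toProfunctor d c)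
        (r : El A.str c X),
        ract (P := B.str) (show El B.str d ((mapF F.functor).obj X) from F.Θ.app d X (cmk h r))
          (σ.familyHom X) = G.Θ.app d X (cmk (σ.app d c h) r) := by
  -- The left-hand pasting first produces the pair of `Θ_F(h, r)` with an identity of ultrafamilies;
  -- `β σ` turns that identity into the family of values of `σ` at identities, and normalizing the
  -- pair moves this family onto `Θ_F(h, r)`.
  have key (d : D) (c : C) (X : UltraFamily.{w} C) (h : El F.functor.toProfunctor d c)
      (r : El A.str c X) :
      ((TwoCell.whiskerLeft B.str σ.betaExt).vcomp ((reprCell B.str F.functor).vcomp F.Θ)).app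
        d X (cmk h r) = (reprCell B.str G.functor).app d X
          (ract (P := B.str) (show El B.str d ((mapF F.functor).obj X) from F.Θ.app d X (cmk h r))
            (σ.familyHom X)) :=
    cmk_eq_reprCell B.str G.functor _ (σ.familyHom X)
  constructor
  · intro H d c X h r
    -- Both sides are compared after applying `reprCell`; the right-hand pasting is already of the
    -- form `reprCell` applied to `Θ_G(σ h, r)`, by definition.
    refine reprCell_injective B.str G.functor d X ((key d c X h r).symm.trans ?_)
    rw [H]
    rfl
  · intro H
    ext d X x
    -- Every element of `f_⋄ ∘ A` is the class of a pair, so the elementwise equations determine the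
    -- equality of `2`-cells.
    induction x using pcomp_ind with | _ c h r
    exact (key d c X h r).trans (congrArg ((reprCell B.str G.functor).app d X) (H d c X h r))

end AlgebraTwoCell

/-! ### Transformations, natural transformations of functors of points, and algebra `2`-cells. -/

variable {A : UltraconvergenceSpace.{w, u₁}} {B : UltraconvergenceSpace.{w, u₂}}
  {f g : ContinuousMap A B}

/-- The condition on a transformation, in terms of the actions of the category of points. -/
theorem transformation_comm_iff
    (α : ∀ a : A.Pt, El B.conv (f.functor.obj a) ((unit B.Pt).obj (g.functor.obj a)))
    {a : A.Pt} {X : UltraFamily.{w} A.Pt} (r : El A.conv a X) :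
    ract (B.comp (α a) (fun _ => g.map r)) (lun ((mapF g.functor).obj X)) =
        ract (B.comp (f.map r) (fun x => α (X.obj x))) (run ((mapF g.functor).obj X)) ↔
      B.toLaxAlgebra.act (b := g.functor.obj a) (X := (mapF g.functor).obj X) (α a) (g.map r) =
        B.toLaxAlgebra.coact (X := (mapF f.functor).obj X) (Y := (mapF g.functor).obj X) (f.map r)
          (UGerm.of (E := fun i j => El B.conv (f.functor.obj (X.obj i))
            ((unit B.Pt).obj (g.functor.obj (X.obj j)))) id (Ultrafilter.map_id _)
            fun x => α (X.obj x)) := by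
  have h₁ : B.toLaxAlgebra.act (b := g.functor.obj a) (X := (mapF g.functor).obj X) (α a)
      (g.map r) = ract (B.comp (α a) (fun _ => g.map r)) (lun ((mapF g.functor).obj X)) := by
    refine congrArg (fun x => ract (P := B.conv) x (lun ((mapF g.functor).obj X))) ?_
    -- The multiplication of the lax algebra reindexes its first argument along the underlying
    -- function of the representative before composing. That function is the identity here, so the
    -- reindexing is by an identity and disappears.
    exact UltraconvergenceSpace.comp_congr (A := B) (X := (unit B.Pt).obj (g.functor.obj a))
      (c := fun _ => (mapF g.functor).obj X) (ract_id (P := B.conv) (α a)) fun _ => rfl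
  have h₂ : B.toLaxAlgebra.coact (X := (mapF f.functor).obj X) (Y := (mapF g.functor).obj X)
      (f.map r) (UGerm.of (E := fun i j => El B.conv (f.functor.obj (X.obj i))
        ((unit B.Pt).obj (g.functor.obj (X.obj j)))) id (Ultrafilter.map_id _)
        fun x => α (X.obj x)) =
      ract (B.comp (f.map r) (fun x => α (X.obj x))) (run ((mapF g.functor).obj X)) := by
    refine congrArg (fun x => ract (P := B.conv) x (run ((mapF g.functor).obj X))) ?_
    -- Again the representative lies over the identity function, so the reindexing of `f.map r` is
    -- trivial.
    exact UltraconvergenceSpace.comp_congr (A := B) (X := (mapF f.functor).obj X)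
      (c := fun x => (unit B.Pt).obj (g.functor.obj (X.obj x))) (ract_id (P := B.conv) (f.map r))
      fun _ => rfl
  exact ⟨fun h => h₁.trans (h.trans h₂.symm), fun h => h₁.symm.trans (h.trans h₂)⟩

/-- The natural transformation between functors of points given by a transformation. -/
noncomputable def Transformation.natTrans (α : Transformation f g) : f.ptFunctor ⟶ g.ptFunctor where
  app a := α.app a
  -- A morphism `r` of the category of points is an arrow into a one-point family. For such a
  -- target, the covariant action by a component of `α` is definitionally composition of points (as
  -- in `LaxAlgebra.coact_unit`), so the transformation law at `r` is the naturality square.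
  naturality _ _ r := ((transformation_comm_iff α.app r).1 (α.comm r)).symm

/-- The `2`-cell `f_⋄ ⇒ g_⋄` given by a natural transformation `f ⟶ g`. -/
def TwoCell.ofNatTrans {C : Type u₁} [Category.{w} C] {D : Type u₂} [Category.{w} D] {f g : C ⥤ D}
    (τ : f ⟶ g) : TwoCell f.toProfunctor g.toProfunctor where
  app d c h := show d ⟶ g.obj c from (show d ⟶ f.obj c from h) ≫ τ.app c
  app_lact h p := Category.assoc h _ _
  app_ract {d c c'} p k := by
    -- Compatibility with the covariant action is the only place where naturality of `τ` enters; the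
    -- contravariant one is mere associativity.
    change ((show d ⟶ f.obj c from p) ≫ f.map k) ≫ τ.app c' =
      ((show d ⟶ f.obj c from p) ≫ τ.app c) ≫ g.map k
    rw [Category.assoc, Category.assoc, τ.naturality]

/-- The values at identities are `𝟙 ≫ τ_c`; removing these identities gives the family of components
in the form in which it appears in `transformation_comm_iff`. -/
theorem TwoCell.familyHom_ofNatTrans {C : Type u₁} [Category.{w} C] {D : Type u₂} [Category.{w} D]
    {f g : C ⥤ D} (τ : f ⟶ g) (X : UltraFamily.{w} C) :
    (TwoCell.ofNatTrans τ).familyHom X = homMk (X := (mapF f).obj X) (Y := (mapF g).obj X) id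
      (Ultrafilter.map_id _) fun x => τ.app (X.obj x) :=
  homMk_eq (X := (mapF f).obj X) (Y := (mapF g).obj X) (Filter.Eventually.of_forall fun x =>
    congrArg (Sigma.mk x) (Category.id_comp (τ.app (X.obj x))))

/-- A `2`-cell `f_⋄ ⇒ g_⋄` is determined by its values at identities. -/
theorem TwoCell.app_eq_comp {C : Type u₁} [Category.{w} C] {D : Type u₂} [Category.{w} D]
    {f g : C ⥤ D} (σ : TwoCell f.toProfunctor g.toProfunctor) {d : D} {c : C} (h : d ⟶ f.obj c) :
    σ.app d c h = h ≫ (show f.obj c ⟶ g.obj c from σ.app (f.obj c) c (𝟙 (f.obj c))) :=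
  -- Yoneda: `h` is the restriction along `h` of the identity of `f c`, and `σ` commutes with
  -- restriction.
  (congrArg (σ.app d c) (Category.comp_id h).symm).trans
    (σ.app_lact h (show El f.toProfunctor (f.obj c) c from 𝟙 (f.obj c)))

/-- The algebra `2`-cell given by a transformation. -/
noncomputable def Transformation.toAlgebraTwoCell (α : Transformation f g) :
    AlgebraTwoCell f.toColax g.toColax where
  cell := TwoCell.ofNatTrans α.natTrans
  comm := by
    refine (algebraTwoCell_comm_iff (F := f.toColax) (G := g.toColax) _).2 fun d c X h r => ?_
    refine (congrArg (ract (P := B.toLaxAlgebra.ptStr) _)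
      (TwoCell.familyHom_ofNatTrans α.natTrans X)).trans ?_
    -- Associativity pulls `h` out of both sides: here out of `(α_{b_x})_x · (f(r) · h)`, and below
    -- out of `g(r) · (α_c · h)`. The re-packaged ultrafamilies have the same data, read over the
    -- discrete category instead of the category of points.
    refine (B.toLaxAlgebra.act_coact (b := f.functor.obj c)
      (X := ⟨X.ι, fun i => f.functor.obj (X.obj i), X.uf⟩)
      (Y := ⟨X.ι, fun i => g.functor.obj (X.obj i), X.uf⟩) h (f.map r) _).symm.trans ?_
    refine Eq.trans ?_ (B.toLaxAlgebra.act_act (b := f.functor.obj c) (c := g.functor.obj c)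
      (X := ⟨X.ι, fun i => g.functor.obj (X.obj i), X.uf⟩) h (α.app c) (g.map r)).symm
    -- What remains inside is the transformation law at `r`, composed with `h`.
    exact congrArg (B.toLaxAlgebra.act (b := f.functor.obj c) h)
      ((transformation_comm_iff (X := ⟨X.ι, X.obj, X.uf⟩) α.app r).1 (α.comm r)).symm

/-- The transformation given by the values of an algebra `2`-cell at identities. -/
noncomputable def AlgebraTwoCell.toTransformation (σ : AlgebraTwoCell f.toColax g.toColax) :
    Transformation f g where
  app a := σ.cell.app (f.toColax.functor.obj a) a (𝟙 (f.toColax.functor.obj a))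
  comm {a X} r := by
    refine (transformation_comm_iff (f := f) (g := g) (fun a => σ.cell.app
      (f.toColax.functor.obj a) a (𝟙 (f.toColax.functor.obj a))) r).2 ?_
    -- The elementwise equation at `h = id`: its right side is already `g(r) · α_a`, and on its left
    -- side `Θ_f(id, r) = f(r) · id` reduces to `f(r)` by the unit law.
    have h := (algebraTwoCell_comm_iff σ.cell).1 σ.comm (f.toColax.functor.obj a) a
      ⟨X.ι, X.obj, X.uf⟩ (𝟙 (f.toColax.functor.obj a)) r
    refine h.symm.trans (congrArg (fun q => B.toLaxAlgebra.coact (X := (mapF f.functor).obj X)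
      (Y := (mapF g.functor).obj X) q _) ?_)
    exact B.toLaxAlgebra.idPt_act (f.map r)

/-- Transformations between continuous maps are the same as algebra `2`-cells between the
corresponding representable colax morphisms. -/
noncomputable def transformationEquiv (f g : ContinuousMap A B) :
    Transformation f g ≃ AlgebraTwoCell f.toColax g.toColax where
  toFun α := α.toAlgebraTwoCell
  invFun σ := σ.toTransformation
  -- The component recovered at `a` is `α_a · id`, the identity of `f a` being that of the category
  -- of points.
  left_inv α := Transformation.ext (funext fun a => B.toLaxAlgebra.idPt_act (α.app a))
  right_inv σ := by
    refine AlgebraTwoCell.ext_cell ?_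
    ext d c h
    -- Rebuilding the `2`-cell from its values at identities gives `h ≫ σ(id)`, which is `σ h` by
    -- Yoneda.
    exact (σ.cell.app_eq_comp h).symm

end UltraConv

theorem mainTheorem12 (A : UltraConv.UltraconvergenceSpace.{w, u₁})
    (B : UltraConv.UltraconvergenceSpace.{w, u₂}) (f g : UltraConv.ContinuousMap A B) :
    ∃ e : UltraConv.Transformation f g ≃ UltraConv.AlgebraTwoCell f.toColax g.toColax,
      ∀ (α : UltraConv.Transformation f g) (a : A.toLaxAlgebra.Pts),
        (e α).cell.app (f.toColax.functor.obj a) a (𝟙 (f.toColax.functor.obj a)) = α.app a := by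
  -- The value of the associated `2`-cell at the identity of `f a` is `α_a · id`, hence `α_a` by the
  -- left unit law of the lax algebra of `B`.
  exact ⟨UltraConv.transformationEquiv f g, fun α a => B.toLaxAlgebra.idPt_act (α.app a)⟩
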